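/- For $d\in\mathbb N$ and $\gamma>0$ put $\Omega=[-\gamma,\gamma]^d$, with $\|u\|_{L^2(\Omega)}=(\int_\Omega u(x)^2\,dx)^{1/2}$ and $\|u\|_{L^\infty(\Omega)}=\sup_{x\in\Omega}|u(x)|$. Let $\mathcal F_{\rm NN}(d,1,L,p,K,\kappa,R)$ be the class of functions $q:\mathbb R^d\to\mathbb R$ of the form $$q(x)=W_L\,\mathrm{ReLU}\bigl(W_{L-1}\cdots\mathrm{ReLU}(W_1x+b_1)\cdots+b_{L-1}\bigr)+b_L$$ with $L$ layers, hidden layers of width at most $p$, at most $K$ nonzero entries in all the $W_l$ and $b_l$ together, all entries at most $\kappa$ in absolute value, and $\sup_{x\in\mathbb R^d}|q(x)|\le R$. **Theorem 1.** Let $d_1,d_2\ge 1$ be integers and $\gamma_1,\gamma_2,\beta_U,\beta_V,L_U,L_V,L_G>0$. Let $\Omega_U=[-\gamma_1,\gamma_1]^{d_1}$ and $\Omega_V=[-\gamma_2,\gamma_2]^{d_2}$. Let $U$ be a set of functions on $\Omega_U$ that are $L_U$-Lipschitz for the Euclidean norm and bounded by $\beta_U$ in absolute value, and $V$ a set of functions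 on $\Omega_V$ that are $L_V$-Lipschitz for the Euclidean norm and bounded by $\beta_V$ in absolute value. There are constants $C>0$, depending only on $d_2,L_V,\gamma_2$, and $C_\delta>0$, depending only on $\gamma_1,d_1,L_G,L_U$, such that the following holds. Let $\varepsilon>0$, $\delta=C_\delta\,\varepsilon$, $N=\lceil C\varepsilon^{-d_2}\rceil$ and $\eta=\min\{\varepsilon,1/2\}$ (so $\eta=\varepsilon$ when $\varepsilon\le 1/2$). Let $c_1,\dots,c_{c_U}\in\Omega_U$ be points such that the closed Euclidean balls of radius $\delta$ around them cover $\Omega_U$. Then there are two network classes, $\mathcal F_1=\mathcal F_{\rm NN}(d_2,1,L_1,p_1,K_1,\kappa_1,1)$ with $$L_1=O(\log\eta^{-1}),\quad p_1=O(1),\quad K_1=O(\log\eta^{-1}),\quad \kappa_1=O(\eta^{-1}),$$ and $\mathcal F_2=\mathcal F_{\rm NN}(c_U,1,L_2,p_2,K_2,\kappa_2,\beta_V)$ with $$L_2=O\bigl(c_U^2\log c_U+c_U^2\log\eta^{-1}\bigr),\qquad p_2=O\bigl(\sqrt{c_U}\,\eta^{-(d_2+1)c_U}\bigr),$$ $$K_2=O\Bigl(\sqrt{c_U}\,\eta^{-(d_2+1)c_U}\bigl(c_U^2\log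 c_U+c_U^2\log\eta^{-1}\bigr)\Bigr),\qquad \kappa_2=O\bigl(c_U^{c_U/2+1}\eta^{-(d_2+1)(c_U+1)}\bigr),$$ such that for every operator $G:U\to V$ with $\|G(u_1)-G(u_2)\|_{L^\infty(\Omega_V)}\le L_G\|u_1-u_2\|_{L^2(\Omega_U)}$ for all $u_1,u_2\in U$, there are trunk nets $\tilde q_1,\dots,\tilde q_N\in\mathcal F_1$ and branch nets $\tilde a_1,\dots,\tilde a_N\in\mathcal F_2$ with $$\sup_{u\in U}\sup_{y\in\Omega_V}\Bigl|G(u)(y)-\sum_{k=1}^N\tilde a_k(\mathbf u)\,\tilde q_k(y)\Bigr|\le\varepsilon,\qquad \mathbf u=[u(c_1),\dots,u(c_{c_U})]^\top .$$ The constants hidden in $O$ depend only on $\gamma_1,\gamma_2,\beta_U,\beta_V,d_1,d_2,L_G,L_U,L_V$, and the bounds hold for all $\varepsilon$ and all such covers. -/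

import Mathlib

/-- The cube `[-γ, γ]^d` in Euclidean `d`-space. -/
def cube (d : ℕ) (γ : ℝ) : Set (EuclideanSpace ℝ (Fin d)) :=
  {x | ∀ i, -γ ≤ x i ∧ x i ≤ γ}

/-- `U` is a set of functions on `[-γ, γ]^d`, each of which is `L`-Lipschitz for the Euclidean
norm and bounded by `β` in absolute value. -/
def IsLipschitzBoundedClass {d : ℕ} {γ : ℝ} (L β : ℝ) (U : Set (cube d γ → ℝ)) : Prop :=
  ∀ u ∈ U, (∀ x₁ x₂ : cube d γ,
      |u x₁ - u x₂| ≤ L * ‖(x₁ : EuclideanSpace ℝ (Fin d)) - (x₂ : EuclideanSpace ℝ (Fin d))‖) ∧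
    ∀ x, |u x| ≤ β

/-- The `L²` norm of a function on `[-γ, γ]^d`, for Lebesgue measure restricted to the cube. -/
noncomputable def l2Norm {d : ℕ} {γ : ℝ} (u : cube d γ → ℝ) : ℝ :=
  Real.sqrt (∫ x, u x ^ 2 ∂(MeasureTheory.volume.comap Subtype.val))

/-- `G : U → V` is Lipschitz with constant `L`, from the `L²` norm to the `L^∞` norm (the supremum
over the whole cube). -/
def IsLipschitzOperator {d₁ d₂ : ℕ} {γ₁ γ₂ : ℝ} {U : Set (cube d₁ γ₁ → ℝ)}
    {V : Set (cube d₂ γ₂ → ℝ)} (L : ℝ) (G : U → V) : Prop :=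
  ∀ u₁ u₂ : U, ∀ y, |(G u₁).1 y - (G u₂).1 y| ≤ L * l2Norm (fun x => u₁.1 x - u₂.1 x)

/-- `ReLUNet n L`: the parameters of a feedforward ReLU network with `n` inputs, one output and
`L` layers. A layer is a weight matrix with a bias vector; all layers except the last one are
followed by the componentwise ReLU. -/
inductive ReLUNet : ℕ → ℕ → Type
  | output {n : ℕ} (W : Matrix (Fin 1) (Fin n) ℝ) (b : Fin 1 → ℝ) : ReLUNet n 1
  | hidden {n m L : ℕ} (W : Matrix (Fin m) (Fin n) ℝ) (b : Fin m → ℝ) (next : ReLUNet m L) :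
      ReLUNet n (L + 1)

namespace ReLUNet

/-- The function realized by a network. -/
noncomputable def eval : {n L : ℕ} → ReLUNet n L → (Fin n → ℝ) → ℝ
  | _, _, output W b, x => (W.mulVec x + b) 0
  | _, _, hidden W b next, x => next.eval (fun i => max ((W.mulVec x + b) i) 0)

/-- All hidden layers have at most `p` neurons. -/
def WidthLE (p : ℕ) : {n L : ℕ} → ReLUNet n L → Prop
  | _, _, output _ _ => True
  | _, _, hidden (m := m) _ _ next => m ≤ p ∧ next.WidthLE p

/-- All weights and biases are at most `κ` in absolute value. -/
def ParamsLE (κ : ℝ) : {n L : ℕ} → ReLUNet n L → Prop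
  | _, _, output W b => (∀ i j, |W i j| ≤ κ) ∧ ∀ i, |b i| ≤ κ
  | _, _, hidden W b next => ((∀ i j, |W i j| ≤ κ) ∧ ∀ i, |b i| ≤ κ) ∧ next.ParamsLE κ

/-- The total number of nonzero weights and biases. -/
noncomputable def nnz : {n L : ℕ} → ReLUNet n L → ℕ
  | _, _, output W b => (∑ i, hammingNorm (W i)) + hammingNorm b
  | _, _, hidden W b next => (∑ i, hammingNorm (W i)) + hammingNorm b + next.nnz

end ReLUNet

/-- The class `F_NN(d, 1, L, p, K, κ, R)` of functions `ℝ^d → ℝ` that are realized by a ReLU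
network with `L` layers, width at most `p`, at most `K` nonzero parameters, all parameters at most
`κ` in absolute value, and that are bounded by `R` on `ℝ^d`. -/
def FNN (d L p K : ℕ) (κ R : ℝ) : Set ((Fin d → ℝ) → ℝ) :=
  {q | (∃ Φ : ReLUNet d L, Φ.eval = q ∧ Φ.WidthLE p ∧ Φ.ParamsLE κ ∧ Φ.nnz ≤ K) ∧
    ∀ x, |q x| ≤ R}

/-! Both variables are discretized by piecewise linear functions. In the output variable, `G u` is
replaced by its interpolant on a regular grid of mesh of order `ε`, written in the nodal functions
of the Kuhn triangulation. They form a partition of unity (`sum_kuhnHat`) supported within one mesh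
of their nodes, so the Lipschitz bound on `V` controls the error (`abs_sub_sum_kuhnHat_le`). They
are the trunk nets and do not depend on `G`.

The coefficients are the functionals `u ↦ G(u)(z)` at grid points `z`. Since the balls around the `c
l` cover the cube, the samples determine `u` in sup norm up to `2 * L_U * δ`. So `G(u)(z)` is, up to
a small error, a Lipschitz function of the sample vector for the maximum norm. It is known at the
members of a finite sup-norm net `T ⊆ U` and is extended from there by McShane's formula
(`abs_sub_mcShane_le`). This extension is the branch net; `T` is chosen before `G`.

Both kinds of functions are maxima of minima of affine functions, and a ReLU net computes such a
function at a cost proportional to the number of affine pieces (`exists_latticeNet`). That number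
depends on `d₂` alone for the trunk, and is `(|T| + 1) * 2n` for the branch, where `n` is the number
of sample points. It remains to bound `|T|` by a power of `1/η` with exponent about `n`
(`IsLipschitzBoundedClass.exists_net_of_cover`). Quantizing the values on a grid gives a bound
exponential in the number of grid points, and a packing argument (`pow_le_card_of_cover`) shows that
a cover of radius `δ` needs enough balls to dominate this exponent. -/

/-! ### ReLU networks for maxima of minima of affine functions -/

namespace ReLUNet

theorem WidthLE.mono {p p' : ℕ} (h : p ≤ p') :
    ∀ {n L : ℕ} {Φ : ReLUNet n L}, Φ.WidthLE p → Φ.WidthLE p'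
  | _, _, output _ _, _ => trivial
  | _, _, hidden _ _ _, hΦ => ⟨hΦ.1.trans h, WidthLE.mono h hΦ.2⟩

theorem ParamsLE.mono {κ κ' : ℝ} (h : κ ≤ κ') :
    ∀ {n L : ℕ} {Φ : ReLUNet n L}, Φ.ParamsLE κ → Φ.ParamsLE κ'
  | _, _, output _ _, hΦ => ⟨fun i j => (hΦ.1 i j).trans h, fun i => (hΦ.2 i).trans h⟩
  | _, _, hidden _ _ _, hΦ =>
    ⟨⟨fun i j => (hΦ.1.1 i j).trans h, fun i => (hΦ.1.2 i).trans h⟩, ParamsLE.mono h hΦ.2⟩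

end ReLUNet

theorem hammingNorm_add_le {n : ℕ} (x y : Fin n → ℝ) :
    hammingNorm (x + y) ≤ hammingNorm x + hammingNorm y := by
  unfold hammingNorm
  refine (Finset.card_le_card ?_).trans (Finset.card_union_le _ _)
  intro i
  simp only [Finset.mem_filter, Finset.mem_univ, true_and, Finset.mem_union, Pi.add_apply]
  contrapose!
  rintro ⟨hx, hy⟩
  rw [hx, hy, add_zero]

theorem hammingNorm_smul_le_self {n : ℕ} (a : ℝ) (x : Fin n → ℝ) :
    hammingNorm (a • x) ≤ hammingNorm x := hammingNorm_smul_le_hammingNorm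

theorem hammingNorm_single_le {n : ℕ} (i : Fin n) (a : ℝ) :
    hammingNorm (Pi.single i a : Fin n → ℝ) ≤ 1 := by
  unfold hammingNorm
  rw [← Finset.card_singleton i]
  refine Finset.card_le_card fun j => ?_
  simp only [Finset.mem_filter, Finset.mem_univ, true_and, Finset.mem_singleton]
  contrapose!
  intro h
  rw [Pi.single_apply, if_neg h]

/-- `F`, applied to the outputs of an arbitrary sparse affine map, is realized by a ReLU network
with `L` layers, width at most `p` and a number of parameters that is at most `k` times the
sparsity of the affine map. -/
def LatticeNet (ι : Type) (L p k : ℕ) (F : (ι → ℝ) → ℝ) : Prop :=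
  ∀ (n : ℕ) (W : ι → Fin n → ℝ) (b : ι → ℝ) (s : ℕ) (κ : ℝ), 4 ≤ s → 3 ≤ κ →
    (∀ i, hammingNorm (W i) + 1 ≤ s) → (∀ i j, |W i j| ≤ κ) → (∀ i, |b i| ≤ κ) →
    ∃ Φ : ReLUNet n L, (∀ x, Φ.eval x = F (fun i => W i ⬝ᵥ x + b i)) ∧
      Φ.WidthLE p ∧ Φ.ParamsLE (2 * κ) ∧ Φ.nnz ≤ k * s

namespace LatticeNet

variable {ι ι' : Type} {L p p' k k' : ℕ} {F : (ι → ℝ) → ℝ}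

theorem mono (h : LatticeNet ι L p k F) (hp : p ≤ p') (hk : k ≤ k') : LatticeNet ι L p' k' F := by
  intro n W b s κ hs hκ h1 h2 h3
  obtain ⟨Φ, e, w, q, z⟩ := h n W b s κ hs hκ h1 h2 h3
  exact ⟨Φ, e, w.mono hp, q, z.trans (Nat.mul_le_mul_right _ hk)⟩

theorem comap (h : LatticeNet ι L p k F) (e : ι → ι') :
    LatticeNet ι' L p k (fun v => F (v ∘ e)) := by
  intro n W b s κ hs hκ h1 h2 h3
  exact h n (W ∘ e) (b ∘ e) s κ hs hκ (fun i => h1 (e i)) (fun i => h2 (e i)) (fun i => h3 (e i))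

theorem unit : LatticeNet Unit 1 0 1 (fun v => v ()) := by
  intro n W b s κ hs hκ h1 h2 h3
  refine ⟨.output (fun _ => W ()) (fun _ => b ()), fun x => ?_, trivial, ?_, ?_⟩
  · simp [ReLUNet.eval, Matrix.mulVec]
  · exact ⟨fun _ j => (h2 () j).trans (by linarith), fun _ => (h3 ()).trans (by linarith)⟩
  · have hb : hammingNorm (fun _ : Fin 1 => b ()) ≤ 1 := hammingNorm_le_card_fintype
    have := h1 ()
    simp only [ReLUNet.nnz, Finset.univ_unique, Finset.sum_singleton, one_mul]
    omega

/-- One hidden layer performs a pairwise maximum (`σ = 1`) or minimum (`σ = -1`). Three neurons per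
pair suffice: the positive and negative parts of one entry, which carry it through the ReLU, and the
rectified difference. -/
theorem step [Fintype ι] (h : LatticeNet ι L p k F) {σ : ℝ} (hσ : |σ| ≤ 1)
    (hp : 3 * Fintype.card ι ≤ p) :
    LatticeNet (ι × Bool) (L + 1) p (6 * Fintype.card ι + k)
      (fun v => F fun i => v (i, false) + σ * max (σ * (v (i, true) - v (i, false))) 0) := by
  intro n W b s κ hs hκ h1 h2 h3
  let e : Fin 3 × ι ≃ Fin (Fintype.card (Fin 3 × ι)) := Fintype.equivFin _
  have hm : Fintype.card (Fin 3 × ι) = 3 * Fintype.card ι := by simp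
  let V : Fin 3 × ι → Fin n → ℝ := fun t =>
    ![W (t.2, false), (-1 : ℝ) • W (t.2, false),
      σ • (W (t.2, true) + (-1 : ℝ) • W (t.2, false))] t.1
  let a : Fin 3 × ι → ℝ := fun t =>
    ![b (t.2, false), -b (t.2, false), σ * (b (t.2, true) - b (t.2, false))] t.1
  let W' : ι → Fin (Fintype.card (Fin 3 × ι)) → ℝ := fun i =>
    Pi.single (e (0, i)) 1 + Pi.single (e (1, i)) (-1) + Pi.single (e (2, i)) σ
  have hcard : ∀ i, hammingNorm (W' i) + 1 ≤ 4 := by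
    intro i
    have q1 := hammingNorm_single_le (e (0, i)) 1
    have q2 := hammingNorm_single_le (e (1, i)) (-1)
    have q3 := hammingNorm_single_le (e (2, i)) σ
    have q4 := hammingNorm_add_le (Pi.single (e (0, i)) 1) (Pi.single (e (1, i)) (-1))
    have q5 := hammingNorm_add_le (Pi.single (e (0, i)) 1 + Pi.single (e (1, i)) (-1))
      (Pi.single (e (2, i)) σ)
    simp only [W']
    omega
  have hsingle : ∀ (t j : Fin (Fintype.card (Fin 3 × ι))) (c : ℝ), |c| ≤ 1 →
      |(Pi.single t c : Fin (Fintype.card (Fin 3 × ι)) → ℝ) j| ≤ 1 := by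
    intro t j c hc
    rw [Pi.single_apply]
    split_ifs
    · exact hc
    · simp
  have hW' : ∀ i j, |W' i j| ≤ 3 := by
    intro i j
    refine (abs_add_three _ _ _).trans ?_
    have q1 := hsingle (e (0, i)) j 1 (by simp)
    have q2 := hsingle (e (1, i)) j (-1) (by simp)
    have q3 := hsingle (e (2, i)) j σ hσ
    linarith
  -- The later layers see only rows with three entries of size at most one, whatever `s` and `κ`
  -- are. Hence the parameters do not grow with the depth, and sparsity beyond 4 is paid for only in
  -- the first layer.
  obtain ⟨Φ, hev, hw, hpar, hz⟩ := h _ W' 0 4 3 le_rfl le_rfl hcard hW' (by simp)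
  have hVrow : ∀ t, hammingNorm (V t) + 1 ≤ 2 * s := by
    rintro ⟨t, i⟩
    have q1 := h1 (i, false)
    have q2 := h1 (i, true)
    have q3 := hammingNorm_smul_le_self (-1) (W (i, false))
    have q4 := hammingNorm_add_le (W (i, true)) ((-1 : ℝ) • W (i, false))
    have q5 := hammingNorm_smul_le_self σ (W (i, true) + (-1 : ℝ) • W (i, false))
    fin_cases t <;> simp only [V] <;> simp <;> simp at q3 q4 q5 <;> omega
  have hdiff : ∀ x y : ℝ, |x| ≤ κ → |y| ≤ κ → |σ * (x - y)| ≤ 2 * κ := by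
    intro x y hx hy
    rw [abs_mul]
    have := abs_sub x y
    nlinarith [abs_nonneg (x - y)]
  have hVle : ∀ t j, |V t j| ≤ 2 * κ := by
    rintro ⟨t, i⟩ j
    have q1 := h2 (i, false) j
    have q2 := hdiff _ _ (h2 (i, true) j) q1
    fin_cases t
    · simp [V]; linarith
    · simp [V]; linarith
    · simpa [V, sub_eq_add_neg, mul_add] using q2
  have hale : ∀ t, |a t| ≤ 2 * κ := by
    rintro ⟨t, i⟩
    have q1 := h3 (i, false)
    have q2 := hdiff _ _ (h3 (i, true)) q1
    fin_cases t
    · simp [a]; linarith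
    · simp [a]; linarith
    · simpa [a] using q2
  refine ⟨.hidden (fun t => V (e.symm t)) (fun t => a (e.symm t)) Φ, fun x => ?_,
    ⟨by rw [hm]; exact hp, hw⟩, ⟨⟨fun t j => hVle _ j, fun t => hale _⟩, hpar.mono (by linarith)⟩,
    ?_⟩
  · simp only [ReLUNet.eval]
    rw [hev]
    congr 1
    funext i
    simp only [W', add_dotProduct, single_dotProduct, Pi.zero_apply, add_zero, Pi.add_apply,
      Matrix.mulVec, Equiv.symm_apply_apply, one_mul]
    simp only [V, a, Matrix.cons_val, smul_dotProduct, add_dotProduct, smul_eq_mul]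
    have : ∀ y : ℝ, max y 0 - max (-y) 0 = y := fun y => max_zero_sub_max_neg_zero_eq_self y
    have q := this (W (i, false) ⬝ᵥ x + b (i, false))
    rw [show -1 * W (i, false) ⬝ᵥ x + -b (i, false) = -(W (i, false) ⬝ᵥ x + b (i, false)) by ring,
      show σ * (W (i, true) ⬝ᵥ x + -1 * W (i, false) ⬝ᵥ x) + σ * (b (i, true) - b (i, false)) =
        σ * (W (i, true) ⬝ᵥ x + b (i, true) - (W (i, false) ⬝ᵥ x + b (i, false))) by ring]
    linarith
  · simp only [ReLUNet.nnz]
    have hb : hammingNorm (fun t => a (e.symm t)) ≤ Fintype.card (Fin 3 × ι) := by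
      simpa using hammingNorm_le_card_fintype (x := fun t => a (e.symm t))
    have hsum : (∑ t, (hammingNorm (V (e.symm t)) + 1)) ≤ Fintype.card (Fin 3 × ι) * (2 * s) := by
      refine (Finset.sum_le_card_nsmul _ _ (2 * s) fun t _ => hVrow _).trans ?_
      simp
    rw [Finset.sum_add_distrib] at hsum
    simp only [Finset.sum_const, Finset.card_univ, Fintype.card_fin, smul_eq_mul, mul_one] at hsum
    have hN : Fintype.card (Fin 3 × ι) * (2 * s) = 6 * Fintype.card ι * s := by rw [hm]; ring
    have : k * 4 ≤ k * s := Nat.mul_le_mul_left _ hs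
    rw [add_mul]
    omega

theorem max_step [Fintype ι] (h : LatticeNet ι L p k F) (hp : 3 * Fintype.card ι ≤ p) :
    LatticeNet (ι × Bool) (L + 1) p (6 * Fintype.card ι + k)
      (fun v => F fun i => max (v (i, true)) (v (i, false))) := by
  convert h.step (σ := 1) (by simp) hp using 4 with v i
  rcases le_total (v (i, true)) (v (i, false)) with q | q
  · rw [max_eq_right q, max_eq_right (by linarith)]; ring
  · rw [max_eq_left q, max_eq_left (by linarith)]; ring

theorem min_step [Fintype ι] (h : LatticeNet ι L p k F) (hp : 3 * Fintype.card ι ≤ p) :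
    LatticeNet (ι × Bool) (L + 1) p (6 * Fintype.card ι + k)
      (fun v => F fun i => min (v (i, true)) (v (i, false))) := by
  convert h.step (σ := -1) (by simp) hp using 4 with v i
  rcases le_total (v (i, true)) (v (i, false)) with q | q
  · rw [min_eq_left q, max_eq_left (by linarith)]; ring
  · rw [min_eq_right q, max_eq_right (by linarith)]; ring

/-- A binary tournament, with the final comparison nearest to the output. The level with `2 ^ j`
comparisons per index adds `6 * card ι * 2 ^ j` to `k`; the geometric sum `6 * card ι * (2 ^ D - 1)`
is stated without subtraction. -/
theorem iSup_bool_pow : ∀ (D : ℕ) {ι : Type} [Fintype ι] {L p k k' : ℕ} {F : (ι → ℝ) → ℝ},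
    LatticeNet ι L p k F → 3 * (Fintype.card ι * 2 ^ D) ≤ p →
    6 * (Fintype.card ι * 2 ^ D) + k ≤ k' + 6 * Fintype.card ι →
    LatticeNet (ι × (Fin D → Bool)) (L + D) p k' (fun v => F fun i => ⨆ t, v (i, t))
  | 0, ι, _, L, p, k, k', F, h, _, hk => by
    convert (h.comap (fun i => (i, (Fin.elim0 : Fin 0 → Bool)))).mono le_rfl
      (show k ≤ k' by simp at hk; omega) using 2 with v
    · rfl
    refine congrArg F (funext fun i => ?_)
    rw [ciSup_unique]
    simp only [Function.comp_apply]
    congr 2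
  | D + 1, ι, _, L, p, k, k', F, h, hp, hk => by
    have hc : Fintype.card (ι × Bool) = 2 * Fintype.card ι := by simp [mul_comm]
    have hpow : 1 ≤ 2 ^ D := Nat.one_le_two_pow
    rw [pow_succ] at hp hk
    have h' := iSup_bool_pow D (k' := k') (h.max_step (p := p) (by nlinarith)) (by rw [hc]; linarith)
      (by rw [hc]; linarith)
    have h'' := h'.comap (fun t => (t.1.1, (Fin.cons t.1.2 t.2 : Fin (D + 1) → Bool)))
    rw [add_assoc, add_comm 1 D] at h''
    convert h'' using 3 with v
    funext i
    simp only [Function.comp_apply]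
    have hb : ∀ f : (Fin (D + 1) → Bool) → ℝ, BddAbove (Set.range f) := fun f =>
      (Set.finite_range f).bddAbove
    have hb' : ∀ f : (Fin D → Bool) → ℝ, BddAbove (Set.range f) := fun f =>
      (Set.finite_range f).bddAbove
    apply le_antisymm
    · refine ciSup_le fun t => ?_
      rw [← Fin.cons_self_tail t]
      cases t 0
      · exact (le_ciSup (hb' fun r => v (i, Fin.cons false r)) _).trans (le_max_right _ _)
      · exact (le_ciSup (hb' fun r => v (i, Fin.cons true r)) _).trans (le_max_left _ _)
    · exact max_le (ciSup_le fun t => le_ciSup (hb fun r => v (i, r)) _)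
        (ciSup_le fun t => le_ciSup (hb fun r => v (i, r)) _)

theorem iInf_bool_pow : ∀ (D : ℕ) {ι : Type} [Fintype ι] {L p k k' : ℕ} {F : (ι → ℝ) → ℝ},
    LatticeNet ι L p k F → 3 * (Fintype.card ι * 2 ^ D) ≤ p →
    6 * (Fintype.card ι * 2 ^ D) + k ≤ k' + 6 * Fintype.card ι →
    LatticeNet (ι × (Fin D → Bool)) (L + D) p k' (fun v => F fun i => ⨅ t, v (i, t))
  | 0, ι, _, L, p, k, k', F, h, _, hk => by
    convert (h.comap (fun i => (i, (Fin.elim0 : Fin 0 → Bool)))).mono le_rfl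
      (show k ≤ k' by simp at hk; omega) using 2 with v
    · rfl
    refine congrArg F (funext fun i => ?_)
    rw [ciInf_unique]
    simp only [Function.comp_apply]
    congr 2
  | D + 1, ι, _, L, p, k, k', F, h, hp, hk => by
    have hc : Fintype.card (ι × Bool) = 2 * Fintype.card ι := by simp [mul_comm]
    have hpow : 1 ≤ 2 ^ D := Nat.one_le_two_pow
    rw [pow_succ] at hp hk
    have h' := iInf_bool_pow D (k' := k') (h.min_step (p := p) (by nlinarith)) (by rw [hc]; linarith)
      (by rw [hc]; linarith)
    have h'' := h'.comap (fun t => (t.1.1, (Fin.cons t.1.2 t.2 : Fin (D + 1) → Bool)))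
    rw [add_assoc, add_comm 1 D] at h''
    convert h'' using 3 with v
    funext i
    simp only [Function.comp_apply]
    have hb : ∀ f : (Fin (D + 1) → Bool) → ℝ, BddBelow (Set.range f) := fun f =>
      (Set.finite_range f).bddBelow
    have hb' : ∀ f : (Fin D → Bool) → ℝ, BddBelow (Set.range f) := fun f =>
      (Set.finite_range f).bddBelow
    apply le_antisymm
    · exact le_min (le_ciInf fun t => ciInf_le (hb fun r => v (i, r)) _)
        (le_ciInf fun t => ciInf_le (hb fun r => v (i, r)) _)
    · refine le_ciInf fun t => ?_
      rw [← Fin.cons_self_tail t]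
      cases t 0
      · exact (min_le_right _ _).trans (ciInf_le (hb' fun r => v (i, Fin.cons false r)) _)
      · exact (min_le_left _ _).trans (ciInf_le (hb' fun r => v (i, Fin.cons true r)) _)

end LatticeNet

/-- Repeating indices changes neither a supremum nor an infimum, so an index set can be padded to a
power of two while at most doubling it. -/
theorem exists_surjective_bool_pow (τ : Type) [Fintype τ] [Nonempty τ] :
    ∃ (D : ℕ) (g : (Fin D → Bool) → τ), Function.Surjective g ∧ 2 ^ D ≤ 2 * Fintype.card τ := by
  refine ⟨Nat.clog 2 (Fintype.card τ), ?_⟩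
  have h : Fintype.card τ ≤ Fintype.card (Fin (Nat.clog 2 (Fintype.card τ)) → Bool) := by
    simpa using Nat.le_pow_clog one_lt_two _
  obtain ⟨f⟩ := Function.Embedding.nonempty_of_card_le h
  refine ⟨Function.invFun f, Function.invFun_surjective f.injective, ?_⟩
  rcases Nat.lt_or_ge 1 (Fintype.card τ) with h1 | h1
  · have := Nat.pow_pred_clog_lt_self one_lt_two h1
    have hpos : 0 < Nat.clog 2 (Fintype.card τ) := Nat.clog_pos one_lt_two h1
    obtain ⟨D, hD⟩ := Nat.exists_eq_succ_of_ne_zero hpos.ne'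
    rw [hD] at this ⊢
    simp only [Nat.pred_succ] at this
    rw [pow_succ]
    omega
  · have := Fintype.card_pos (α := τ)
    rw [Nat.clog_of_right_le_one h1]
    omega

/-- A maximum over `J` of minima over `I` of sparse affine functions is realized by a ReLU network
whose size is proportional to the number of affine functions. -/
theorem exists_latticeNet (J I : Type) [Fintype J] [Fintype I] [Nonempty J] [Nonempty I] :
    ∃ L p k : ℕ, 2 ^ L ≤ 8 * (Fintype.card J * Fintype.card I) ∧
      p ≤ 12 * (Fintype.card J * Fintype.card I) ∧
      k ≤ 25 * (Fintype.card J * Fintype.card I) ∧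
      LatticeNet (J × I) L p k (fun v => ⨆ j, ⨅ i, v (j, i)) := by
  obtain ⟨D₁, g₁, hg₁, hD₁⟩ := exists_surjective_bool_pow J
  obtain ⟨D₂, g₂, hg₂, hD₂⟩ := exists_surjective_bool_pow I
  have hJ := Fintype.card_pos (α := J)
  have hI := Fintype.card_pos (α := I)
  have hp₁ : 1 ≤ 2 ^ D₁ := Nat.one_le_two_pow
  have hp₂ : 1 ≤ 2 ^ D₂ := Nat.one_le_two_pow
  have hmul : 2 ^ D₁ * 2 ^ D₂ ≤ 4 * (Fintype.card J * Fintype.card I) := by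
    calc 2 ^ D₁ * 2 ^ D₂ ≤ (2 * Fintype.card J) * (2 * Fintype.card I) := Nat.mul_le_mul hD₁ hD₂
      _ = _ := by ring
  have h₁ := LatticeNet.iSup_bool_pow D₁ (p := 3 * (2 ^ D₁ * 2 ^ D₂)) (k' := 6 * 2 ^ D₁ + 1)
    (LatticeNet.unit.mono (Nat.zero_le _) le_rfl) (by simp; nlinarith) (by simp)
  have h₂ := LatticeNet.iInf_bool_pow D₂ (k' := 6 * (2 ^ D₁ * 2 ^ D₂) + 1) h₁ (by simp)
    (by simp; omega)
  refine ⟨1 + D₁ + D₂, 3 * (2 ^ D₁ * 2 ^ D₂), 6 * (2 ^ D₁ * 2 ^ D₂) + 1, ?_, ?_, ?_, ?_⟩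
  rotate_left 3
  · convert h₂.comap (fun t => (g₁ t.1.2, g₂ t.2)) using 2 with v
    simp only [Function.comp_apply]
    rw [← hg₁.iSup_comp]
    congr 1
    funext t
    exact (hg₂.iInf_comp (fun i => v (g₁ t, i))).symm
  · rw [pow_add, pow_add, pow_one]
    linarith
  · linarith
  · nlinarith

theorem exists_maxMin_mem_FNN (J I : Type) [Fintype J] [Fintype I] [Nonempty J] [Nonempty I] :
    ∃ L p k : ℕ, 2 ^ L ≤ 8 * (Fintype.card J * Fintype.card I) ∧
      p ≤ 12 * (Fintype.card J * Fintype.card I) ∧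
      k ≤ 25 * (Fintype.card J * Fintype.card I) ∧
      ∀ (n : ℕ) (W : J → I → Fin n → ℝ) (b : J → I → ℝ) (s : ℕ) (κ R : ℝ), 4 ≤ s → 3 ≤ κ →
        (∀ j i, hammingNorm (W j i) + 1 ≤ s) → (∀ j i l, |W j i l| ≤ κ) →
        (∀ j i, |b j i| ≤ κ) → (∀ x, |⨆ j, ⨅ i, (W j i ⬝ᵥ x + b j i)| ≤ R) →
        (fun x => ⨆ j, ⨅ i, (W j i ⬝ᵥ x + b j i)) ∈ FNN n L p (k * s) (2 * κ) R := by
  obtain ⟨L, p, k, hL, hp, hk, h⟩ := exists_latticeNet J I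
  refine ⟨L, p, k, hL, hp, hk, fun n W b s κ R hs hκ h1 h2 h3 hR => ⟨?_, hR⟩⟩
  obtain ⟨Φ, e, w, q, z⟩ := h n (fun t => W t.1 t.2) (fun t => b t.1 t.2) s κ hs hκ
    (fun t => h1 _ _) (fun t => h2 _ _) (fun t => h3 _ _)
  exact ⟨Φ, funext e, w, q, z⟩

/-! ### The Kuhn partition of unity -/

/-- A piecewise linear function of the offsets `z = k - x` of a point `x` from a lattice point `k`
(extended by `z none = 0`): the nodal function of `k` for the Kuhn triangulation. -/
noncomputable def kuhnHat {d : ℕ} (z : Option (Fin d) → ℝ) : ℝ :=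
  ⨆ j : Bool, ⨅ t : Option (Fin d) × Option (Fin d), cond j (1 - z t.1 + z t.2) 0

def latticeOffset {d m : ℕ} (k : Fin d → Fin (m + 1)) (x : Fin d → ℝ) (o : Option (Fin d)) : ℝ :=
  o.elim 0 (fun i => (k i : ℝ) - x i)

section KuhnHat

open MeasureTheory

variable {d m : ℕ}

theorem kuhnHat_eq (z : Option (Fin d) → ℝ) : kuhnHat z = max (1 + (⨅ o, z o) - ⨆ o, z o) 0 := by
  have ha : BddAbove (Set.range z) := (Set.finite_range z).bddAbove
  have hb : BddBelow (Set.range z) := (Set.finite_range z).bddBelow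
  have hmin : (⨅ t : Option (Fin d) × Option (Fin d), (1 - z t.1 + z t.2)) =
      1 + (⨅ o, z o) - ⨆ o, z o := by
    apply le_antisymm
    · obtain ⟨o₁, h₁⟩ := exists_eq_ciSup_of_finite (f := z)
      obtain ⟨o₂, h₂⟩ := exists_eq_ciInf_of_finite (f := z)
      refine (ciInf_le (Set.finite_range _).bddBelow (o₁, o₂)).trans ?_
      rw [← h₁, ← h₂]
      simp only
      linarith
    · refine le_ciInf fun t => ?_
      linarith [le_ciSup ha t.1, ciInf_le hb t.2]
  have hB : BddAbove (Set.range fun j : Bool => ⨅ t : Option (Fin d) × Option (Fin d),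
      cond j (1 - z t.1 + z t.2) 0) := (Set.finite_range _).bddAbove
  unfold kuhnHat
  apply le_antisymm
  · refine ciSup_le fun j => ?_
    cases j
    · simp
    · simp only [cond_true, hmin]
      exact le_max_left _ _
  · refine max_le ?_ ?_
    · rw [← hmin]
      exact le_ciSup hB true
    · refine le_trans ?_ (le_ciSup hB false)
      simp

theorem kuhnHat_nonneg (z : Option (Fin d) → ℝ) : 0 ≤ kuhnHat z := by
  rw [kuhnHat_eq]
  exact le_max_right _ _

theorem kuhnHat_le_one (z : Option (Fin d) → ℝ) : kuhnHat z ≤ 1 := by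
  rw [kuhnHat_eq]
  refine max_le ?_ zero_le_one
  linarith [ciInf_le (Set.finite_range z).bddBelow none, le_ciSup (Set.finite_range z).bddAbove none]

theorem kuhnHat_eq_zero {z : Option (Fin d) → ℝ} (h0 : z none = 0) {i : Option (Fin d)}
    (hi : 1 < |z i|) : kuhnHat z = 0 := by
  rw [kuhnHat_eq]
  refine max_eq_right ?_
  have ha : BddAbove (Set.range z) := (Set.finite_range z).bddAbove
  have hb : BddBelow (Set.range z) := (Set.finite_range z).bddBelow
  rcases lt_abs.1 hi with h | h
  · linarith [le_ciSup ha i, ciInf_le hb none]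
  · linarith [le_ciSup ha none, ciInf_le hb i]

/-- `kuhnHat (latticeOffset k x)` is the length of the set of `t ∈ [0, 1)` for which `k` is the
coordinatewise floor of `x + t`. Every `t` has exactly one such `k`, so the lengths add up to 1. -/
theorem sum_kuhnHat {x : Fin d → ℝ} (hx : ∀ i, 0 ≤ x i ∧ x i ≤ m) :
    ∑ k : Fin d → Fin (m + 1), kuhnHat (latticeOffset k x) = 1 := by
  -- The index `none`, with offset 0, confines this interval to `[0, 1)`; an index `some i` says
  -- that `k i` is the floor of `x i + t`.
  let A : (Fin d → Fin (m + 1)) → Set ℝ := fun k =>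
    Set.Ico (⨆ o, latticeOffset k x o) (1 + ⨅ o, latticeOffset k x o)
  have hmem : ∀ k t, t ∈ A k ↔ ∀ o, latticeOffset k x o ≤ t ∧ t < 1 + latticeOffset k x o := by
    intro k t
    have ha : BddAbove (Set.range (latticeOffset k x)) := (Set.finite_range _).bddAbove
    have hb : BddBelow (Set.range (latticeOffset k x)) := (Set.finite_range _).bddBelow
    constructor
    · rintro ⟨h1, h2⟩ o
      exact ⟨(le_ciSup ha o).trans h1, h2.trans_le (by linarith [ciInf_le hb o])⟩
    · intro h
      refine ⟨ciSup_le fun o => (h o).1, ?_⟩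
      obtain ⟨o, ho⟩ := exists_eq_ciInf_of_finite (f := latticeOffset k x)
      rw [← ho]
      exact (h o).2
  have hdisj : Pairwise (Function.onFun Disjoint A) := by
    intro k k' hk
    refine Set.disjoint_left.2 fun t h1 h2 => hk ?_
    funext i
    have q1 := (hmem k t).1 h1 (some i)
    have q2 := (hmem k' t).1 h2 (some i)
    simp only [latticeOffset, Option.elim_some] at q1 q2
    have r1 : ((k i : ℕ) : ℝ) < ((k' i : ℕ) : ℝ) + 1 := by linarith
    have r2 : ((k' i : ℕ) : ℝ) < ((k i : ℕ) : ℝ) + 1 := by linarith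
    norm_cast at r1 r2
    exact Fin.ext (by omega)
  have hunion : ⋃ k, A k = Set.Ico 0 1 := by
    ext t
    simp only [Set.mem_iUnion, hmem]
    constructor
    · rintro ⟨k, h⟩
      simpa [latticeOffset] using h none
    · intro ht
      have hnn : ∀ i, 0 ≤ x i + t := fun i => add_nonneg (hx i).1 ht.1
      refine ⟨fun i => ⟨⌊x i + t⌋₊, ?_⟩, ?_⟩
      · rw [Nat.floor_lt (hnn i)]
        push_cast
        linarith [(hx i).2, ht.2]
      · rintro (_ | i)
        · simpa [latticeOffset] using ht
        · simp only [latticeOffset, Option.elim_some]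
          have := Nat.floor_le (hnn i)
          have := Nat.lt_floor_add_one (x i + t)
          constructor <;> linarith
  have hvol : ∀ k, kuhnHat (latticeOffset k x) = volume.real (A k) := fun k => by
    rw [kuhnHat_eq, Real.volume_real_Ico]
  simp_rw [hvol]
  rw [← measureReal_iUnion_fintype hdisj (fun k => measurableSet_Ico) (fun k => by simp [A]), hunion]
  simp

/-- The sum is a convex combination in which only lattice points within one mesh of `x` have nonzero
weight. -/
theorem abs_sub_sum_kuhnHat_le {x : Fin d → ℝ} (hx : ∀ i, 0 ≤ x i ∧ x i ≤ m) {v e : ℝ}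
    {g : (Fin d → Fin (m + 1)) → ℝ}
    (hg : ∀ k, (∀ i, |(k i : ℝ) - x i| ≤ 1) → |v - g k| ≤ e) :
    |v - ∑ k, g k * kuhnHat (latticeOffset k x)| ≤ e := by
  have h1 : v - ∑ k, g k * kuhnHat (latticeOffset k x) =
      ∑ k, (v - g k) * kuhnHat (latticeOffset k x) := by
    simp_rw [sub_mul]
    rw [Finset.sum_sub_distrib, ← Finset.mul_sum, sum_kuhnHat hx, mul_one]
  have h2 : e = ∑ k : Fin d → Fin (m + 1), e * kuhnHat (latticeOffset k x) := by
    rw [← Finset.mul_sum, sum_kuhnHat hx, mul_one]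
  rw [h1, h2]
  refine (Finset.abs_sum_le_sum_abs _ _).trans (Finset.sum_le_sum fun k _ => ?_)
  rw [abs_mul, abs_of_nonneg (kuhnHat_nonneg _)]
  by_cases h : ∀ i, |(k i : ℝ) - x i| ≤ 1
  · exact mul_le_mul_of_nonneg_right (hg k h) (kuhnHat_nonneg _)
  · push Not at h
    obtain ⟨i, hi⟩ := h
    rw [kuhnHat_eq_zero (i := some i) rfl hi]
    simp

end KuhnHat

/-! ### Regular grids on the cube -/

section Grid

/-- The point with index `k` of the regular grid with `m` intervals per axis on `[-γ, γ]^d`. -/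
noncomputable def gridPoint {d m : ℕ} (γ : ℝ) (k : Fin d → Fin (m + 1)) :
    EuclideanSpace ℝ (Fin d) :=
  WithLp.toLp 2 fun i => -γ + 2 * γ / m * k i

/-- The coordinates of a point of `[-γ, γ]^d` in units of the mesh. -/
noncomputable def gridCoord {d : ℕ} (m : ℕ) (γ : ℝ) (y : Fin d → ℝ) (i : Fin d) : ℝ :=
  (y i + γ) * (m / (2 * γ))

theorem EuclideanSpace.norm_le_card_mul {d : ℕ} {x : EuclideanSpace ℝ (Fin d)} {a : ℝ}
    (h : ∀ i, |x i| ≤ a) : ‖x‖ ≤ d * a := by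
  rcases Nat.eq_zero_or_pos d with rfl | hd
  · simp [EuclideanSpace.norm_eq]
  have ha : 0 ≤ a := (abs_nonneg _).trans (h ⟨0, hd⟩)
  have hd' : (1 : ℝ) ≤ d := by exact_mod_cast hd
  rw [EuclideanSpace.norm_eq]
  refine Real.sqrt_le_iff.2 ⟨by positivity, ?_⟩
  calc ∑ i, ‖x i‖ ^ 2 ≤ ∑ _i : Fin d, a ^ 2 :=
        Finset.sum_le_sum fun i _ => pow_le_pow_left₀ (norm_nonneg _) (h i) 2
    _ = d * a ^ 2 := by simp
    _ ≤ (d * a) ^ 2 := by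
        rw [mul_pow]
        exact mul_le_mul_of_nonneg_right (by nlinarith) (sq_nonneg a)

variable {d m : ℕ} {γ : ℝ}

theorem gridPoint_mem_cube (hγ : 0 < γ) (k : Fin d → Fin (m + 1)) : gridPoint γ k ∈ cube d γ := by
  intro i
  have hk : ((k i : ℕ) : ℝ) ≤ m := by exact_mod_cast Nat.lt_succ_iff.1 (k i).2
  have h0 : 0 ≤ 2 * γ / m * ((k i : ℕ) : ℝ) := by positivity
  have h1 : 2 * γ / m * ((k i : ℕ) : ℝ) ≤ 2 * γ := by
    rcases Nat.eq_zero_or_pos m with rfl | hm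
    · simp; linarith
    · have : (0 : ℝ) < m := by exact_mod_cast hm
      rw [div_mul_eq_mul_div, div_le_iff₀ this]
      nlinarith
  simp only [gridPoint]
  constructor <;> linarith

theorem gridCoord_mem (hγ : 0 < γ) {y : EuclideanSpace ℝ (Fin d)} (hy : y ∈ cube d γ) (i : Fin d) :
    0 ≤ gridCoord m γ y i ∧ gridCoord m γ y i ≤ m := by
  obtain ⟨h1, h2⟩ := hy i
  unfold gridCoord
  have hm : (0 : ℝ) ≤ m / (2 * γ) := by positivity
  constructor
  · exact mul_nonneg (by linarith) hm
  · calc (y i + γ) * (m / (2 * γ)) ≤ (2 * γ) * (m / (2 * γ)) :=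
        mul_le_mul_of_nonneg_right (by linarith) hm
      _ = m := by field_simp

theorem norm_sub_gridPoint_le (hγ : 0 < γ) {a : ℝ} (ha : 0 < a) (hm : m = ⌊a⌋₊)
    {y : EuclideanSpace ℝ (Fin d)} (hy : y ∈ cube d γ) {k : Fin d → Fin (m + 1)}
    (hk : ∀ i, |(k i : ℝ) - gridCoord m γ y i| ≤ 1) :
    ‖y - gridPoint γ k‖ ≤ d * (4 * γ / a) := by
  refine EuclideanSpace.norm_le_card_mul fun i => ?_
  have hlt : a < m + 1 := hm ▸ Nat.lt_floor_add_one a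
  have hki := hk i
  obtain ⟨h1, h2⟩ := hy i
  simp only [PiLp.sub_apply, gridPoint]
  rw [le_div_iff₀ ha]
  -- For `m = 0` the division by zero leaves the single node `-γ` on each axis; then `a < 1`, and
  -- the bound exceeds the side of the cube. For `m ≥ 1`, `a < m + 1 ≤ 2 * m` bounds the mesh `2γ/m`
  -- by `4γ/a`.
  rcases Nat.eq_zero_or_pos m with h0 | h0
  · have hm0 : (m : ℝ) = 0 := by exact_mod_cast h0
    rw [hm0] at hlt ⊢
    simp only [div_zero, zero_mul, add_zero, zero_add] at hlt ⊢
    rw [abs_of_nonneg (by linarith)]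
    nlinarith
  · have hm0 : (1 : ℝ) ≤ m := by exact_mod_cast h0
    have : y i - (-γ + 2 * γ / m * (k i : ℝ)) =
        -(2 * γ / m * ((k i : ℝ) - gridCoord m γ y i)) := by
      unfold gridCoord
      field_simp
      ring
    rw [this, abs_neg, abs_mul, abs_of_pos (by positivity)]
    calc 2 * γ / m * |(k i : ℝ) - gridCoord m γ y i| * a ≤ 2 * γ / m * 1 * (2 * m) := by
          gcongr
          linarith
      _ = 4 * γ := by field_simp; ring

theorem exists_norm_sub_gridPoint_le (hγ : 0 < γ) {a : ℝ} (ha : 0 < a) (hm : m = ⌊a⌋₊)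
    {y : EuclideanSpace ℝ (Fin d)} (hy : y ∈ cube d γ) :
    ∃ k : Fin d → Fin (m + 1), ‖y - gridPoint γ k‖ ≤ d * (4 * γ / a) := by
  have hc := fun i => gridCoord_mem (m := m) hγ hy i
  refine ⟨fun i => ⟨⌊gridCoord m γ y i⌋₊, Nat.lt_succ_of_le (Nat.floor_le_of_le (hc i).2)⟩,
    norm_sub_gridPoint_le hγ ha hm hy fun i => ?_⟩
  have := Nat.floor_le (hc i).1
  have := Nat.lt_floor_add_one (gridCoord m γ y i)
  rw [abs_le]
  constructor <;> simp only <;> linarith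

end Grid

/-! ### Metric entropy of Lipschitz classes and the size of covers -/

theorem card_Icc_floor_le (B : ℝ) {r : ℝ} (hr : 0 < r) (hB : 0 ≤ B) :
    ((Finset.Icc ⌊-B / r⌋ ⌊B / r⌋).card : ℝ) ≤ 2 * B / r + 2 := by
  have h0 : 0 ≤ B / r := by positivity
  have h1 : ⌊-B / r⌋ ≤ ⌊B / r⌋ := Int.floor_le_floor (by rw [neg_div]; linarith)
  have h2 : (((⌊B / r⌋ + 1 - ⌊-B / r⌋).toNat : ℕ) : ℝ) = ((⌊B / r⌋ + 1 - ⌊-B / r⌋ : ℤ) : ℝ) := by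
    exact_mod_cast Int.toNat_of_nonneg (by omega)
  rw [Int.card_Icc, h2]
  push_cast
  have := Int.floor_le (B / r)
  have := Int.lt_floor_add_one (-B / r)
  rw [neg_div] at *
  rw [mul_div_assoc]
  linarith

/-- Divide the range of `f` into cells of side `r` and keep one member of `U` per occupied cell. The
net thus lies inside `U`, which is needed because `G` is defined only there. -/
theorem exists_finset_net {α ι : Type*} [Fintype ι] {U : Set α} {f : α → ι → ℝ} {B : ι → ℝ}
    (hB₀ : ∀ i, 0 ≤ B i) (hB : ∀ u ∈ U, ∀ i, |f u i| ≤ B i) {r : ℝ} (hr : 0 < r) :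
    ∃ T : Finset α, (T : Set α) ⊆ U ∧ (T.card : ℝ) ≤ ∏ i, (2 * B i / r + 2) ∧
      ∀ u ∈ U, ∃ u' ∈ T, ∀ i, |f u i - f u' i| ≤ r := by
  classical
  let Φ : α → ι → ℤ := fun u i => ⌊f u i / r⌋
  let S : Finset (ι → ℤ) := Fintype.piFinset fun i => Finset.Icc ⌊-B i / r⌋ ⌊B i / r⌋
  have hΦ : Φ '' U ⊆ S := by
    rintro _ ⟨u, hu, rfl⟩
    simp only [S, Finset.mem_coe, Fintype.mem_piFinset, Finset.mem_Icc, Φ]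
    intro i
    have := abs_le.1 (hB u hu i)
    exact ⟨Int.floor_le_floor (div_le_div_of_nonneg_right this.1 hr.le),
      Int.floor_le_floor (div_le_div_of_nonneg_right this.2 hr.le)⟩
  obtain ⟨U', hU', hbij⟩ := Set.exists_subset_bijOn U Φ
  have hfin : U'.Finite := by
    refine Set.Finite.of_finite_image ?_ hbij.injOn
    exact (S.finite_toSet.subset hΦ).subset (Set.image_mono hU')
  refine ⟨hfin.toFinset, by simpa using hU', ?_, fun u hu => ?_⟩
  · have h1 : hfin.toFinset.card ≤ S.card := by
      refine Finset.card_le_card_of_injOn Φ (fun u hu => ?_) ?_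
      · exact hΦ ⟨u, hU' (by simpa using hu), rfl⟩
      · simpa using hbij.injOn
    calc (hfin.toFinset.card : ℝ) ≤ S.card := by exact_mod_cast h1
      _ = ∏ i, ((Finset.Icc ⌊-B i / r⌋ ⌊B i / r⌋).card : ℝ) := by
          simp [S, Fintype.card_piFinset]
      _ ≤ _ := Finset.prod_le_prod (fun _ _ => Nat.cast_nonneg _)
          fun i _ => card_Icc_floor_le _ hr (hB₀ i)
  · obtain ⟨u', hu', he⟩ := hbij.surjOn ⟨u, hu, rfl⟩
    refine ⟨u', by simpa using hu', fun i => ?_⟩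
    have h := congrFun he i
    simp only [Φ] at h
    have := Int.abs_sub_lt_one_of_floor_eq_floor h
    rw [← sub_div, abs_div, abs_of_pos hr, div_lt_one hr, abs_sub_comm] at this
    exact this.le

theorem norm_sub_le_of_mem_cube {d : ℕ} {γ : ℝ} {x y : EuclideanSpace ℝ (Fin d)}
    (hx : x ∈ cube d γ) (hy : y ∈ cube d γ) : ‖x - y‖ ≤ d * (2 * γ) := by
  refine EuclideanSpace.norm_le_card_mul fun i => ?_
  obtain ⟨h1, h2⟩ := hx i
  obtain ⟨h3, h4⟩ := hy i
  simp only [PiLp.sub_apply]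
  rw [abs_le]
  constructor <;> linarith

theorem IsLipschitzBoundedClass.exists_net {d : ℕ} {γ L β : ℝ} {U : Set (cube d γ → ℝ)}
    (hU : IsLipschitzBoundedClass L β U) (hγ : 0 < γ) (hL : 0 ≤ L) (hβ : 0 ≤ β) {r a : ℝ}
    (hr : 0 < r) (ha : 0 < a) (hra : L * (d * (4 * γ / a)) ≤ r / 4) :
    ∃ T : Finset (cube d γ → ℝ), (T : Set (cube d γ → ℝ)) ⊆ U ∧
      (T.card : ℝ) ≤ (8 * β / r + 2) * (16 * d * γ * L / r + 2) ^ ((⌊a⌋₊ + 1) ^ d - 1) ∧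
      ∀ u ∈ U, ∃ u' ∈ T, ∀ x, |u x - u' x| ≤ r := by
  obtain ⟨m, hm⟩ : ∃ m, m = ⌊a⌋₊ := ⟨_, rfl⟩
  let p : (Fin d → Fin (m + 1)) → cube d γ := fun k => ⟨gridPoint γ k, gridPoint_mem_cube hγ k⟩
  -- Only the value at one base node is measured against `β`; the others enter as increments,
  -- bounded through `L`. So `β` stays out of the base of the exponential, and later out of the
  -- constant in `δ`.
  let f : (cube d γ → ℝ) → (Fin d → Fin (m + 1)) → ℝ := fun u k =>
    if k = 0 then u (p 0) else u (p k) - u (p 0)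
  let B : (Fin d → Fin (m + 1)) → ℝ := fun k => if k = 0 then β else L * (d * (2 * γ))
  have hB₀ : ∀ k, 0 ≤ B k := by
    intro k
    simp only [B]
    split_ifs <;> positivity
  have hB : ∀ u ∈ U, ∀ k, |f u k| ≤ B k := by
    intro u hu k
    simp only [f, B]
    split_ifs
    · exact (hU u hu).2 _
    · exact ((hU u hu).1 _ _).trans
        (mul_le_mul_of_nonneg_left (norm_sub_le_of_mem_cube (p k).2 (p 0).2) hL)
  obtain ⟨T, hT, hcard, hnet⟩ := exists_finset_net hB₀ hB (show 0 < r / 4 by positivity)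
  refine ⟨T, hT, hcard.trans (le_of_eq ?_), fun u hu => ?_⟩
  · rw [Fintype.prod_eq_mul_prod_compl 0, ← hm]
    have : ∀ k ∈ ({0}ᶜ : Finset (Fin d → Fin (m + 1))),
        2 * B k / (r / 4) + 2 = 16 * d * γ * L / r + 2 := by
      intro k hk
      have hk0 : k ≠ 0 := by simpa using hk
      simp only [B, if_neg hk0]
      field_simp
      ring
    rw [Finset.prod_congr rfl this, Finset.prod_const, Finset.card_compl]
    simp only [B, if_true, Finset.card_singleton, Fintype.card_pi, Fintype.card_fin,
      Finset.prod_const, Finset.card_univ]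
    congr 1
    field_simp
    ring
  · obtain ⟨u', hu', h⟩ := hnet u hu
    refine ⟨u', hu', fun x => ?_⟩
    obtain ⟨k, hk⟩ := exists_norm_sub_gridPoint_le hγ ha hm x.2
    have h0 := h 0
    simp only [f, if_true] at h0
    -- Base value and increment each err by at most `r / 4`; moving from `x` to the node costs `r /
    -- 4` for each of `u` and `u'`.
    have hpk : |u (p k) - u' (p k)| ≤ r / 2 := by
      by_cases hk0 : k = 0
      · rw [hk0]; linarith
      · have h1 := h k
        simp only [f, if_neg hk0] at h1
        rw [abs_le] at *
        constructor <;> linarith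
    have hd := mul_le_mul_of_nonneg_left hk hL
    have h2 := (hU u hu).1 x (p k)
    have h3 := (hU u' (hT hu')).1 x (p k)
    have h4 : L * ‖(x : EuclideanSpace ℝ (Fin d)) - (p k : EuclideanSpace ℝ (Fin d))‖ ≤ r / 4 :=
      hd.trans hra
    rw [abs_le] at *
    constructor <;> linarith

/-- Distinct grid points are at least `2γ/m > 2δ` apart, so no ball of radius `δ` contains two of
them. -/
theorem pow_le_card_of_cover {d m n : ℕ} {γ δ : ℝ} (hγ : 0 < γ) (c : Fin n → cube d γ)
    (hcov : cube d γ ⊆ ⋃ l, Metric.closedBall (c l : EuclideanSpace ℝ (Fin d)) δ)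
    (hm : (m + 1) * δ < γ) : (m + 1) ^ d ≤ n := by
  have h : ∀ k : Fin d → Fin (m + 1), ∃ l, ‖gridPoint γ k - (c l : EuclideanSpace ℝ (Fin d))‖ ≤ δ := by
    intro k
    simpa [Metric.mem_closedBall, dist_eq_norm] using hcov (gridPoint_mem_cube hγ k)
  choose l hl using h
  have hinj : Function.Injective l := by
    intro k k' hkk
    funext i
    have h1 := hl k
    have h2 := hl k'
    rw [← hkk] at h2
    have h3 : ‖gridPoint γ k - gridPoint γ k'‖ ≤ 2 * δ := by
      have := norm_sub_le (gridPoint γ k - (c (l k) : EuclideanSpace ℝ (Fin d)))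
        (gridPoint γ k' - (c (l k) : EuclideanSpace ℝ (Fin d)))
      rw [sub_sub_sub_cancel_right] at this
      linarith
    have h4 := (PiLp.norm_apply_le (gridPoint γ k - gridPoint γ k') i).trans h3
    by_contra hne
    have hne' : ((k i : ℕ) : ℤ) - (k' i : ℕ) ≠ 0 := fun h0 => hne (Fin.ext (by omega))
    have h5 : (1 : ℝ) ≤ |((k i : ℕ) : ℝ) - (k' i : ℕ)| := by
      exact_mod_cast Int.one_le_abs hne'
    have hm0 : (0 : ℝ) < m := by
      have : 0 < m := by
        have := (k i).2
        have := (k' i).2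
        omega
      exact_mod_cast this
    have h6 : (gridPoint γ k - gridPoint γ k') i = 2 * γ / m * (((k i : ℕ) : ℝ) - (k' i : ℕ)) := by
      simp only [gridPoint, PiLp.sub_apply]
      ring
    rw [h6, Real.norm_eq_abs, abs_mul, abs_of_pos (by positivity)] at h4
    have h7 : 2 * γ / m * 1 ≤ 2 * δ :=
      (mul_le_mul_of_nonneg_left h5 (by positivity)).trans h4
    rw [mul_one, div_le_iff₀ hm0] at h7
    have hδ : 0 ≤ δ := (norm_nonneg _).trans h1
    nlinarith
  simpa using Fintype.card_le_of_injective l hinj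

/-! ### From the sup norm to the L² norm -/

section L2

open MeasureTheory

/-- An upper bound for the norm of the embedding of `L^∞` into `L²` on `[-γ, γ]^d`. -/
noncomputable def cubeL2Const (γ : ℝ) (d : ℕ) : ℝ :=
  Real.sqrt ((volume.comap (Subtype.val : cube d γ → EuclideanSpace ℝ (Fin d))).real Set.univ) + 1

theorem cubeL2Const_pos (γ : ℝ) (d : ℕ) : 0 < cubeL2Const γ d := by
  unfold cubeL2Const
  positivity

theorem measurableSet_cube (d : ℕ) (γ : ℝ) : MeasurableSet (cube d γ) := by
  have : cube d γ = ⋂ i, {x | -γ ≤ x i ∧ x i ≤ γ} := by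
    ext x
    simp [cube]
  rw [this]
  refine MeasurableSet.iInter fun i => (IsClosed.measurableSet ?_)
  have hc : Continuous fun x : EuclideanSpace ℝ (Fin d) => x i := by fun_prop
  exact (isClosed_le continuous_const hc).inter (isClosed_le hc continuous_const)

theorem isFiniteMeasure_comap_cube (d : ℕ) (γ : ℝ) :
    IsFiniteMeasure (volume.comap (Subtype.val : cube d γ → EuclideanSpace ℝ (Fin d))) := by
  constructor
  rw [comap_subtype_coe_apply (measurableSet_cube d γ), Set.image_univ, Subtype.range_coe]
  refine Bornology.IsBounded.measure_lt_top ?_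
  rw [Metric.isBounded_iff]
  exact ⟨d * (2 * γ), fun x hx y hy => by
    rw [dist_eq_norm]; exact norm_sub_le_of_mem_cube hx hy⟩

theorem l2Norm_le {d : ℕ} {γ : ℝ} {u : cube d γ → ℝ} {S : ℝ} (hS : 0 ≤ S) (hu : ∀ x, |u x| ≤ S) :
    l2Norm u ≤ cubeL2Const γ d * S := by
  have := isFiniteMeasure_comap_cube d γ
  have h1 := norm_integral_le_of_norm_le_const
    (μ := volume.comap (Subtype.val : cube d γ → EuclideanSpace ℝ (Fin d)))
    (f := fun x => u x ^ 2) (C := S ^ 2) (Filter.Eventually.of_forall fun x => by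
      rw [Real.norm_eq_abs, abs_pow]
      exact pow_le_pow_left₀ (abs_nonneg _) (hu x) 2)
  have h2 := (le_abs_self _).trans h1
  unfold l2Norm
  refine (Real.sqrt_le_sqrt h2).trans ?_
  rw [Real.sqrt_mul (sq_nonneg S), Real.sqrt_sq hS]
  unfold cubeL2Const
  rw [mul_comm S]
  exact mul_le_mul_of_nonneg_right (by linarith) hS

theorem IsLipschitzOperator.abs_sub_le {d₁ d₂ : ℕ} {γ₁ γ₂ L S : ℝ} {U : Set (cube d₁ γ₁ → ℝ)}
    {V : Set (cube d₂ γ₂ → ℝ)} {G : U → V} (hG : IsLipschitzOperator L G) (hL : 0 ≤ L)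
    (hS : 0 ≤ S) {u₁ u₂ : U} (hu : ∀ x, |u₁.1 x - u₂.1 x| ≤ S) (y : cube d₂ γ₂) :
    |(G u₁).1 y - (G u₂).1 y| ≤ L * cubeL2Const γ₁ d₁ * S := by
  rw [mul_assoc]
  exact (hG u₁ u₂ y).trans (mul_le_mul_of_nonneg_left (l2Norm_le hS hu) hL)

end L2

/-! ### Trunk networks -/

/-- The number of affine pieces of a hat depends on `d` alone; `m` and `γ` enter only through the
size of the weights. The zero function is included to fill unused trunk indices. -/
theorem exists_trunk_class (d : ℕ) : ∃ L p K : ℕ, ∀ (m : ℕ) (γ : ℝ), 0 < γ →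
    (∀ k : Fin d → Fin (m + 1), (fun y => kuhnHat (latticeOffset k (gridCoord m γ y))) ∈
      FNN d L p K (2 * (3 + m * (1 + 1 / γ))) 1) ∧
    (fun _ => 0) ∈ FNN d L p K (2 * (3 + m * (1 + 1 / γ))) 1 := by
  obtain ⟨L, p, k, -, -, -, h⟩ := exists_maxMin_mem_FNN Bool (Option (Fin d) × Option (Fin d))
  refine ⟨L, p, k * (d + 4), fun m γ hγ => ⟨fun l => ?_, ?_⟩⟩
  · let w : Option (Fin d) → Fin d → ℝ := fun o => o.elim 0 fun i => Pi.single i (-(m / (2 * γ)))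
    let c : Option (Fin d) → ℝ := fun o => o.elim 0 fun i => (l i : ℝ) - m / 2
    have hw : ∀ o i, |w o i| ≤ m / (2 * γ) := by
      rintro (_ | o) i
      · simp only [w, Option.elim_none, Pi.zero_apply, abs_zero]
        positivity
      · simp only [w, Option.elim_some, Pi.single_apply]
        split_ifs
        · rw [abs_neg, abs_of_nonneg (by positivity)]
        · simp only [abs_zero]
          positivity
    have hc : ∀ o, |c o| ≤ m / 2 := by
      rintro (_ | o)
      · simp only [c, Option.elim_none, abs_zero]
        positivity
      · have : ((l o : ℕ) : ℝ) ≤ m := by exact_mod_cast Nat.lt_succ_iff.1 (l o).2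
        have : (0 : ℝ) ≤ (l o : ℕ) := Nat.cast_nonneg _
        simp only [c, Option.elim_some]
        rw [abs_le]
        constructor <;> linarith
    have hz : ∀ o y, latticeOffset l (gridCoord m γ y) o = w o ⬝ᵥ y + c o := by
      rintro (_ | o) y
      · simp [latticeOffset, w, c]
      · simp only [latticeOffset, w, c, Option.elim_some, single_dotProduct, gridCoord]
        field_simp
        ring
    have hfun : (fun y => kuhnHat (latticeOffset l (gridCoord m γ y))) = fun y =>
        ⨆ j : Bool, ⨅ t : Option (Fin d) × Option (Fin d),
          ((cond j (w t.2 - w t.1) 0 : Fin d → ℝ) ⬝ᵥ y + cond j (1 - c t.1 + c t.2) 0) := by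
      funext y
      unfold kuhnHat
      congr 1
      funext j
      congr 1
      funext t
      cases j
      · simp
      · simp only [cond_true, hz, sub_dotProduct]
        ring
    have hpos : 0 ≤ (m : ℝ) * (1 + 1 / γ) := by positivity
    have hexp : (m : ℝ) * (1 + 1 / γ) = m + 2 * (m / (2 * γ)) := by field_simp
    have hpos' : 0 ≤ (m : ℝ) / (2 * γ) := by positivity
    have hbd : ∀ y, |kuhnHat (latticeOffset l (gridCoord m γ y))| ≤ 1 := fun y => by
      rw [abs_of_nonneg (kuhnHat_nonneg _)]
      exact kuhnHat_le_one _
    rw [hfun]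
    refine h d (fun j t => cond j (w t.2 - w t.1) 0) (fun j t => cond j (1 - c t.1 + c t.2) 0)
      (d + 4) (3 + m * (1 + 1 / γ)) 1 (by omega) (by linarith) ?_ ?_ ?_ fun y => ?_
    · intro j t
      have : hammingNorm (cond j (w t.2 - w t.1) 0 : Fin d → ℝ) ≤ Fintype.card (Fin d) :=
        hammingNorm_le_card_fintype
      rw [Fintype.card_fin] at this
      omega
    · rintro (_ | _) t i
      · simp only [cond_false, Pi.zero_apply, abs_zero]
        linarith
      · simp only [cond_true, Pi.sub_apply]
        have := abs_sub (w t.2 i) (w t.1 i)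
        have := hw t.2 i
        have := hw t.1 i
        have : (0 : ℝ) ≤ m := Nat.cast_nonneg _
        linarith
    · rintro (_ | _) t
      · simp only [cond_false, abs_zero]
        linarith
      · simp only [cond_true]
        have q1 := abs_le.1 (hc t.1)
        have q2 := abs_le.1 (hc t.2)
        have : (0 : ℝ) ≤ m := Nat.cast_nonneg _
        rw [abs_le]
        constructor <;> linarith
    · have := congrFun hfun y
      rw [← this]
      exact hbd y
  · have hpos : 0 ≤ (m : ℝ) * (1 + 1 / γ) := by positivity
    have := h d (fun _ _ => (0 : Fin _ → ℝ)) (fun _ _ => 0) (d + 4) (3 + m * (1 + 1 / γ)) 1 (by omega)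
      (by linarith) (by simp) (fun _ _ _ => by rw [Pi.zero_apply, abs_zero]; linarith)
      (fun _ _ => by rw [abs_zero]; linarith) (by simp)
    simpa using this

/-! ### Branch networks by McShane extension -/

/-- The lower McShane extension of the data `g t` at the nodes `w t`, for the Lipschitz constant
`Λ` and the maximum norm, truncated from below at `-β`. -/
noncomputable def mcShane {T : Type} {n : ℕ} (w : T → Fin n → ℝ) (g : T → ℝ) (Λ β : ℝ)
    (v : Fin n → ℝ) : ℝ :=
  ⨆ j : Option T, ⨅ i : Fin n × Bool,
    j.elim (-β) fun t => g t + cond i.2 Λ (-Λ) * (v i.1 - w t i.1)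

section McShane

variable {T : Type} {n : ℕ} {w : T → Fin n → ℝ} {g : T → ℝ} {Λ β : ℝ}

/-- The minimum over coordinates and signs equals `-Λ` times the maximum-norm distance from `v` to
`w t`, so a single coordinate suffices for an upper bound. -/
theorem mcShane_le {v : Fin n → ℝ} [NeZero n] {M : ℝ} (hβ : -β ≤ M)
    (h : ∀ t, ∃ i, g t - Λ * |v i - w t i| ≤ M) : mcShane w g Λ β v ≤ M := by
  refine ciSup_le fun j => ?_
  cases j with
  | none => simpa using hβ
  | some t =>
    obtain ⟨i, hi⟩ := h t
    rcases le_total 0 (v i - w t i) with h0 | h0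
    · refine (ciInf_le (Set.finite_range _).bddBelow (i, false)).trans ?_
      rw [abs_of_nonneg h0] at hi
      simp only [Option.elim_some, cond_false]
      linarith
    · refine (ciInf_le (Set.finite_range _).bddBelow (i, true)).trans ?_
      rw [abs_of_nonpos h0] at hi
      simp only [Option.elim_some, cond_true]
      linarith

variable [Fintype T]

theorem neg_le_mcShane [NeZero n] (v : Fin n → ℝ) : -β ≤ mcShane w g Λ β v := by
  refine le_trans ?_ (le_ciSup (Set.finite_range _).bddAbove none)
  simp

theorem sub_le_mcShane [NeZero n] (hΛ : 0 ≤ Λ) {v : Fin n → ℝ} {t : T} {S : ℝ}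
    (h : ∀ i, |v i - w t i| ≤ S) : g t - Λ * S ≤ mcShane w g Λ β v := by
  refine le_trans ?_ (le_ciSup (Set.finite_range _).bddAbove (some t))
  refine le_ciInf fun i => ?_
  have := abs_le.1 (h i.1)
  simp only [Option.elim_some]
  cases i.2 <;> simp only [cond_true, cond_false] <;> nlinarith

theorem abs_mcShane_le [NeZero n] (hΛ : 0 ≤ Λ) (hβ : 0 ≤ β) (hg : ∀ t, |g t| ≤ β)
    (v : Fin n → ℝ) : |mcShane w g Λ β v| ≤ β := by
  refine abs_le.2 ⟨neg_le_mcShane v, mcShane_le (by linarith) fun t => ⟨0, ?_⟩⟩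
  have := (abs_le.1 (hg t)).2
  nlinarith [mul_nonneg hΛ (abs_nonneg (v 0 - w t 0))]

/-- From above, each `t` is tested at its exact distance from `v`, which costs only `e`. From below,
one net point within `r` suffices: `Λ * r` is lost in the formula and `Λ * r + e` in comparing `g t`
with `F`. -/
theorem abs_sub_mcShane_le [NeZero n] (hΛ : 0 ≤ Λ) {v : Fin n → ℝ} {F e r : ℝ} (hF : |F| ≤ β)
    (he : 0 ≤ e) (hr : 0 ≤ r)
    (h : ∀ t S, 0 ≤ S → (∀ i, |v i - w t i| ≤ S) → |F - g t| ≤ Λ * S + e)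
    (hnet : ∃ t, ∀ i, |v i - w t i| ≤ r) :
    |F - mcShane w g Λ β v| ≤ 2 * Λ * r + e := by
  have hF' := abs_le.1 hF
  have hΛr : 0 ≤ Λ * r := mul_nonneg hΛ hr
  have hup : mcShane w g Λ β v ≤ F + e := by
    refine mcShane_le (by linarith) fun t => ?_
    obtain ⟨i, hi⟩ := exists_eq_ciSup_of_finite (f := fun i => |v i - w t i|)
    refine ⟨i, ?_⟩
    have := h t |v i - w t i| (abs_nonneg _) fun l => by
      rw [hi]
      exact le_ciSup (f := fun i => |v i - w t i|) (Set.finite_range _).bddAbove l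
    linarith [(abs_le.1 this).1]
  obtain ⟨t, ht⟩ := hnet
  have hlow := sub_le_mcShane (g := g) (β := β) hΛ ht
  have := abs_le.1 (h t r hr ht)
  rw [abs_le]
  constructor <;> linarith

/-- Each affine piece involves at most one coordinate, so the sparsity parameter is 4 and the
parameter count gains no further factor `n`. -/
theorem exists_branch_class (T : Type) [Fintype T] (n : ℕ) [NeZero n] :
    ∃ L p K : ℕ, 2 ^ L ≤ 8 * ((Fintype.card T + 1) * (2 * n)) ∧
      p ≤ 12 * ((Fintype.card T + 1) * (2 * n)) ∧
      K ≤ 100 * ((Fintype.card T + 1) * (2 * n)) ∧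
      ∀ (Λ β B : ℝ), 0 ≤ Λ → 0 ≤ β → 0 ≤ B →
        (∀ (w : T → Fin n → ℝ) (g : T → ℝ), (∀ t i, |w t i| ≤ B) → (∀ t, |g t| ≤ β) →
          mcShane w g Λ β ∈ FNN n L p K (2 * (3 + Λ + β + Λ * B)) β) ∧
        (fun _ => 0) ∈ FNN n L p K (2 * (3 + Λ + β + Λ * B)) β := by
  obtain ⟨L, p, k, hL, hp, hk, h⟩ := exists_maxMin_mem_FNN (Option T) (Fin n × Bool)
  have hJ : Fintype.card (Option T) = Fintype.card T + 1 := Fintype.card_option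
  have hI : Fintype.card (Fin n × Bool) = 2 * n := by simp [mul_comm]
  rw [hJ, hI] at hL hp hk
  refine ⟨L, p, k * 4, hL, hp, by omega, fun Λ β B hΛ hβ hB => ⟨fun w g hw hg => ?_, ?_⟩⟩
  · have hΛB : 0 ≤ Λ * B := mul_nonneg hΛ hB
    let W : Option T → Fin n × Bool → Fin n → ℝ := fun j i =>
      j.elim 0 fun _ => Pi.single i.1 (cond i.2 Λ (-Λ))
    let b : Option T → Fin n × Bool → ℝ := fun j i =>
      j.elim (-β) fun t => g t - cond i.2 Λ (-Λ) * w t i.1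
    have habs : ∀ c : Bool, |cond c Λ (-Λ)| = Λ := by
      rintro (_ | _) <;> simp [abs_of_nonneg hΛ]
    have hfun : mcShane w g Λ β = fun v => ⨆ j, ⨅ i, (W j i ⬝ᵥ v + b j i) := by
      funext v
      unfold mcShane
      congr 1
      funext j
      congr 1
      funext i
      cases j
      · simp [W, b]
      · simp only [W, b, Option.elim_some, single_dotProduct]
        ring
    have hbd := abs_mcShane_le (w := w) hΛ hβ hg
    rw [hfun] at hbd ⊢
    refine h n W b 4 (3 + Λ + β + Λ * B) β le_rfl (by linarith) ?_ ?_ ?_ hbd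
    · rintro (_ | t) i
      · simp [W]
      · simp only [W, Option.elim_some]
        have := hammingNorm_single_le i.1 (cond i.2 Λ (-Λ))
        omega
    · rintro (_ | t) i l
      · simp only [W, Option.elim_none, Pi.zero_apply, abs_zero]
        linarith
      · simp only [W, Option.elim_some, Pi.single_apply]
        split_ifs
        · rw [habs]; linarith
        · rw [abs_zero]; linarith
    · rintro (_ | t) i
      · simp only [b, Option.elim_none, abs_neg, abs_of_nonneg hβ]
        linarith
      · simp only [b, Option.elim_some]
        refine (abs_sub _ _).trans ?_
        rw [abs_mul, habs]
        have := mul_le_mul_of_nonneg_left (hw t i.1) hΛ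
        have := hg t
        linarith
  · have hΛB : 0 ≤ Λ * B := mul_nonneg hΛ hB
    have := h n (fun _ _ => (0 : Fin _ → ℝ)) (fun _ _ => 0) 4 (3 + Λ + β + Λ * B) β le_rfl
      (by linarith) (by simp) (fun _ _ _ => by rw [Pi.zero_apply, abs_zero]; linarith)
      (fun _ _ => by rw [abs_zero]; linarith) (by simpa using hβ)
    simpa using this

end McShane

/-! ### Entropy against the number of sample points -/

/-- The exponent by which the metric entropy of the input class exceeds the number of mesh
points. -/
noncomputable def entropyExponent (c : ℝ) : ℕ := ⌈c + 2⌉₊ + 1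

/-- Each grid increment takes about `C/ε` quantized values, at most `H ^ s`. Shrinking `δ` by the
factor `s` forces the cover to have at least `s` balls per increment, so all increments together
contribute at most `H ^ n`; the base value accounts for the remaining factor `H`. -/
theorem IsLipschitzBoundedClass.exists_net_of_cover {d n : ℕ} {γ L β Λ ε δ H : ℝ}
    {U : Set (cube d γ → ℝ)} (hU : IsLipschitzBoundedClass L β U) (hd : 0 < d) (hγ : 0 < γ)
    (hL : 0 < L) (hβ : 0 ≤ β) (hΛ : 0 < Λ) (hε : 0 < ε) (hH : 2 ≤ H) (hεH : 1 / ε ≤ H)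
    (hδ₀ : 0 ≤ δ)
    (hδ : δ ≤ γ / (4 * entropyExponent (128 * d * γ * L * Λ) * (128 * d * γ * L * Λ)) * ε)
    (c : Fin n → cube d γ)
    (hcov : cube d γ ⊆ ⋃ l, Metric.closedBall (c l : EuclideanSpace ℝ (Fin d)) δ) :
    ∃ T : Finset (cube d γ → ℝ), (T : Set (cube d γ → ℝ)) ⊆ U ∧
      (T.card : ℝ) ≤ (64 * Λ * β + 2) * H ^ (n + 1) ∧
      ∀ u ∈ U, ∃ u' ∈ T, ∀ x, |u x - u' x| ≤ ε / (8 * Λ) := by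
  obtain ⟨C, hC⟩ : ∃ C, C = 128 * d * γ * L * Λ := ⟨_, rfl⟩
  have hd' : (0 : ℝ) < d := by exact_mod_cast hd
  have hC0 : 0 < C := by rw [hC]; positivity
  rw [← hC] at hδ
  obtain ⟨s, hs⟩ : ∃ s, s = entropyExponent C := ⟨_, rfl⟩
  rw [← hs] at hδ
  have hs1 : 1 ≤ s := by rw [hs, entropyExponent]; omega
  have hs1' : (1 : ℝ) ≤ s := by exact_mod_cast hs1
  have ha : 0 < C / ε := by positivity
  obtain ⟨T, hT, hcard, hnet⟩ := hU.exists_net hγ hL.le hβ (r := ε / (8 * Λ)) (a := C / ε)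
    (by positivity) ha (by rw [hC]; field_simp; norm_num)
  refine ⟨T, hT, hcard.trans ?_, hnet⟩
  obtain ⟨m, hm⟩ : ∃ m, m = ⌊C / ε⌋₊ := ⟨_, rfl⟩
  rw [← hm]
  -- For `m = 0` there are no increments and nothing is asked of the cover, which may then be a
  -- single ball. For `m ≥ 1`, the packing bound is applied to the finer grid with `s * (m + 1)`
  -- points per axis.
  have hexp : s * ((m + 1) ^ d - 1) ≤ n := by
    rcases Nat.eq_zero_or_pos m with h0 | h0
    · simp [h0]
    · have hm1 : (1 : ℝ) ≤ m := by exact_mod_cast h0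
      have hma : (m : ℝ) ≤ C / ε := hm ▸ Nat.floor_le ha.le
      obtain ⟨q, hq⟩ : ∃ q, s * (m + 1) = q + 1 :=
        Nat.exists_eq_succ_of_ne_zero (Nat.mul_pos hs1 (Nat.succ_pos m)).ne'
      have hq' : (q : ℝ) + 1 = s * (m + 1) := by exact_mod_cast hq.symm
      have hlt : ((q : ℝ) + 1) * δ < γ := by
        rw [hq']
        calc (s : ℝ) * (m + 1) * δ ≤ s * (2 * (C / ε)) * (γ / (4 * s * C) * ε) := by
              have : (m : ℝ) + 1 ≤ 2 * (C / ε) := by linarith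
              gcongr
          _ = γ / 2 := by field_simp; norm_num
          _ < γ := by linarith
      have hle := pow_le_card_of_cover hγ c hcov hlt
      rw [← hq, mul_pow] at hle
      calc s * ((m + 1) ^ d - 1) ≤ s ^ d * (m + 1) ^ d :=
            Nat.mul_le_mul (Nat.le_self_pow hd.ne' s) (Nat.sub_le _ _)
        _ ≤ n := hle
  have hH0 : 0 ≤ H := by linarith
  have h1 : 8 * β / (ε / (8 * Λ)) + 2 ≤ (64 * Λ * β + 2) * H := by
    have e1 : 8 * β / (ε / (8 * Λ)) = 64 * Λ * β * (1 / ε) := by field_simp; ring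
    rw [e1]
    have : 64 * Λ * β * (1 / ε) ≤ 64 * Λ * β * H := mul_le_mul_of_nonneg_left hεH (by positivity)
    linarith
  -- One factor `H` absorbs `1/ε`. The other `⌈C + 2⌉₊` factors absorb the constant `C + 2`, because
  -- `H ≥ 2`.
  have h2 : 16 * d * γ * L / (ε / (8 * Λ)) + 2 ≤ H ^ s := by
    have e1 : 16 * d * γ * L / (ε / (8 * Λ)) = C * (1 / ε) := by rw [hC]; field_simp; norm_num
    have e2 : C * (1 / ε) ≤ C * H := mul_le_mul_of_nonneg_left hεH hC0.le
    have e3 : C + 2 ≤ H ^ ⌈C + 2⌉₊ := by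
      refine (Nat.le_ceil _).trans ?_
      calc ((⌈C + 2⌉₊ : ℕ) : ℝ) ≤ 2 ^ ⌈C + 2⌉₊ := by exact_mod_cast Nat.lt_two_pow_self.le
        _ ≤ _ := pow_le_pow_left₀ (by norm_num) hH _
    rw [e1, hs, entropyExponent, pow_succ]
    calc C * (1 / ε) + 2 ≤ (C + 2) * H := by linarith
      _ ≤ _ := mul_le_mul_of_nonneg_right e3 hH0
  calc _ ≤ (64 * Λ * β + 2) * H * (H ^ s) ^ ((m + 1) ^ d - 1) := by
        gcongr
    _ = (64 * Λ * β + 2) * (H * H ^ (s * ((m + 1) ^ d - 1))) := by rw [← pow_mul]; ring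
    _ ≤ (64 * Λ * β + 2) * (H * H ^ n) := by
        gcongr
        linarith
    _ = _ := by rw [pow_succ]; ring

theorem nonneg_of_cover {d n : ℕ} {γ δ : ℝ} (hγ : 0 < γ) (c : Fin n → cube d γ)
    (hcov : cube d γ ⊆ ⋃ l, Metric.closedBall (c l : EuclideanSpace ℝ (Fin d)) δ) :
    0 ≤ δ ∧ 0 < n := by
  have h0 : (0 : EuclideanSpace ℝ (Fin d)) ∈ cube d γ := fun i => by
    simp only [PiLp.zero_apply]
    constructor <;> linarith
  obtain ⟨l, hl⟩ := Set.mem_iUnion.1 (hcov h0)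
  exact ⟨dist_nonneg.trans hl, Fin.pos l⟩

/-! ### Size bounds and the error estimate -/

theorem pow_floor_succ_le_ceil (d : ℕ) {c ε : ℝ} (hc : 0 < c) (hε : 0 < ε) :
    (⌊c / ε⌋₊ + 1) ^ d ≤ ⌈(2 * c) ^ d * (1 / ε) ^ d⌉₊ := by
  have hpos : 0 < (2 * c) ^ d * (1 / ε) ^ d := by positivity
  rcases Nat.eq_zero_or_pos ⌊c / ε⌋₊ with h | h
  · rw [h]
    simpa using Nat.ceil_pos.2 hpos
  · have h1 : (1 : ℝ) ≤ (⌊c / ε⌋₊ : ℕ) := by exact_mod_cast h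
    have h2 : ((⌊c / ε⌋₊ : ℕ) : ℝ) ≤ c / ε := Nat.floor_le (by positivity)
    have h3 : (((⌊c / ε⌋₊ + 1) ^ d : ℕ) : ℝ) ≤ (2 * c) ^ d * (1 / ε) ^ d := by
      rw [← mul_pow]
      push_cast
      refine pow_le_pow_left₀ (by positivity) ?_ d
      calc ((⌊c / ε⌋₊ : ℕ) : ℝ) + 1 ≤ 2 * (c / ε) := by linarith
        _ = 2 * c * (1 / ε) := by ring
    exact_mod_cast h3.trans (Nat.le_ceil _)

/-- The size bounds for the branch networks, in terms of the number `q` of affine pieces. -/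
theorem branch_size_bounds {n q L p K e : ℕ} {H B : ℝ} (hn : 0 < n) (hH : 2 ≤ H) (hB : 0 ≤ B)
    (he : 1 ≤ e) (hq : (q : ℝ) ≤ (B + 1) * H ^ (n + 1) * (2 * n)) (hL : 2 ^ L ≤ 8 * q)
    (hp : p ≤ 12 * q) (hK : K ≤ 100 * q) :
    (L : ℝ) ≤ (400 * (B + 1)) * ((n : ℝ) ^ 2 * Real.log n + (n : ℝ) ^ 2 * Real.log H) ∧
    (p : ℝ) ≤ (400 * (B + 1)) * (Real.sqrt n * H ^ ((e + 1) * n)) ∧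
    (K : ℝ) ≤ (400 * (B + 1)) * ((Real.sqrt n * H ^ ((e + 1) * n)) *
      ((n : ℝ) ^ 2 * Real.log n + (n : ℝ) ^ 2 * Real.log H)) := by
  have hn1 : (1 : ℝ) ≤ n := by exact_mod_cast hn
  have hH1 : 1 ≤ H := by linarith
  have hH0 : 0 < H := by linarith
  obtain ⟨X, hX⟩ : ∃ X, X = (n : ℝ) ^ 2 * Real.log n + (n : ℝ) ^ 2 * Real.log H := ⟨_, rfl⟩
  have hlog2 : (1 : ℝ) / 2 ≤ Real.log 2 := by linarith [Real.log_two_gt_d9]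
  have hlogH : (1 : ℝ) / 2 ≤ Real.log H := hlog2.trans (Real.log_le_log (by norm_num) hH)
  have hlogn : 0 ≤ (n : ℝ) ^ 2 * Real.log n := mul_nonneg (sq_nonneg _) (Real.log_nonneg hn1)
  have hXn : n * Real.log H ≤ X := by
    have : (n : ℝ) * Real.log H ≤ (n : ℝ) ^ 2 * Real.log H :=
      mul_le_mul_of_nonneg_right (by nlinarith) (by linarith)
    linarith
  have hX2 : 1 / 2 ≤ X := by nlinarith
  -- The factor `n` is absorbed by `n ≤ 2 ^ (n - 1) ≤ H ^ (n - 1)`. The exponent `2 * n` is then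
  -- within `(e + 1) * n`, since `e ≥ 1`.
  have hq' : (q : ℝ) ≤ 2 * (B + 1) * H ^ (2 * n) := by
    obtain ⟨l, rfl⟩ := Nat.exists_eq_succ_of_ne_zero hn.ne'
    have h1 : ((l.succ : ℕ) : ℝ) ≤ H ^ l := by
      calc ((l.succ : ℕ) : ℝ) ≤ 2 ^ l := by exact_mod_cast Nat.lt_two_pow_self
        _ ≤ _ := pow_le_pow_left₀ (by norm_num) hH _
    calc (q : ℝ) ≤ (B + 1) * H ^ (l.succ + 1) * (2 * H ^ l) := by
          refine hq.trans ?_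
          gcongr
      _ = 2 * (B + 1) * H ^ (2 * l.succ) := by
          rw [show 2 * l.succ = (l.succ + 1) + l by omega, pow_add H (l.succ + 1) l]
          ring
  have hP : H ^ (2 * n) ≤ Real.sqrt n * H ^ ((e + 1) * n) := by
    have h1 : 1 ≤ Real.sqrt n := Real.one_le_sqrt.2 hn1
    have h2 : H ^ (2 * n) ≤ H ^ ((e + 1) * n) :=
      pow_le_pow_right₀ hH1 (Nat.mul_le_mul_right n (by omega))
    have h3 : 0 ≤ H ^ ((e + 1) * n) := by positivity
    nlinarith
  have hqP : (q : ℝ) ≤ 2 * (B + 1) * (Real.sqrt n * H ^ ((e + 1) * n)) :=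
    hq'.trans (mul_le_mul_of_nonneg_left hP (by positivity))
  have hpos : 0 ≤ (B + 1) * (Real.sqrt n * H ^ ((e + 1) * n)) := by positivity
  rw [← hX]
  refine ⟨?_, ?_, ?_⟩
  · have h1 : (2 : ℝ) ^ L ≤ 16 * (B + 1) * H ^ (2 * n) := by
      have : ((2 ^ L : ℕ) : ℝ) ≤ ((8 * q : ℕ) : ℝ) := by exact_mod_cast hL
      push_cast at this
      linarith
    have h2 := Real.log_le_log (by positivity) h1
    rw [Real.log_pow, Real.log_mul (by positivity) (by positivity), Real.log_pow] at h2
    have h3 := Real.log_le_self (show 0 ≤ 16 * (B + 1) by positivity)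
    push_cast at h2
    have h4 : (L : ℝ) * (1 / 2) ≤ L * Real.log 2 := by gcongr
    have h5 : 0 ≤ B * (X - 1 / 2) := mul_nonneg hB (by linarith)
    nlinarith
  · have : (p : ℝ) ≤ 12 * q := by exact_mod_cast hp
    linarith
  · have h1 : (K : ℝ) ≤ 100 * q := by exact_mod_cast hK
    have h2 : 0 ≤ ((B + 1) * (Real.sqrt n * H ^ ((e + 1) * n))) * (X - 1 / 2) :=
      mul_nonneg hpos (by linarith)
    nlinarith

/-- The DeepONet approximation error, for trunk nets forming a partition of unity on a grid and
branch nets interpolating the operator between finitely many input functions. -/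
theorem deepONet_error {d₁ d₂ m n : ℕ} {γ₁ γ₂ β_V L_U L_V L_G Λ ε δ : ℝ} (hγ₂ : 0 < γ₂)
    (hd₂ : 0 < d₂) (hL_U : 0 < L_U) (hL_V : 0 < L_V) (hL_G : 0 < L_G) (hε : 0 < ε) (hδ₀ : 0 ≤ δ)
    (hΛ : Λ = L_G * cubeL2Const γ₁ d₁) (hδ : δ ≤ 1 / (16 * Λ * L_U) * ε)
    (hm : m = ⌊8 * d₂ * γ₂ * L_V / ε⌋₊) [NeZero n]
    {β_U : ℝ} {U : Set (cube d₁ γ₁ → ℝ)} {V : Set (cube d₂ γ₂ → ℝ)}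
    (hU : IsLipschitzBoundedClass L_U β_U U) (hV : IsLipschitzBoundedClass L_V β_V V)
    (c : Fin n → cube d₁ γ₁)
    (hcov : cube d₁ γ₁ ⊆ ⋃ l, Metric.closedBall (c l : EuclideanSpace ℝ (Fin d₁)) δ)
    {T : Finset (cube d₁ γ₁ → ℝ)} (hTU : ∀ t : T, t.1 ∈ U)
    (hT : ∀ u ∈ U, ∃ u' ∈ T, ∀ x, |u x - u' x| ≤ ε / (8 * Λ))
    {G : U → V} (hG : IsLipschitzOperator L_G G) (u : U) (y : cube d₂ γ₂) :
    |(G u).1 y - ∑ k : Fin d₂ → Fin (m + 1),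
      mcShane (fun (t : T) l => t.1 (c l))
        (fun t => (G ⟨t.1, hTU t⟩).1 ⟨gridPoint γ₂ k, gridPoint_mem_cube hγ₂ k⟩) Λ β_V
        (fun l => u.1 (c l)) *
      kuhnHat (latticeOffset k (gridCoord m γ₂ (y : EuclideanSpace ℝ (Fin d₂))))| ≤ ε := by
  have hΛ0 : 0 < Λ := by rw [hΛ]; exact mul_pos hL_G (cubeL2Const_pos _ _)
  have hd₂' : (0 : ℝ) < d₂ := by exact_mod_cast hd₂
  refine abs_sub_sum_kuhnHat_le (fun i => gridCoord_mem hγ₂ y.2 i) fun k hk => ?_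
  obtain ⟨z, hz⟩ : ∃ z : cube d₂ γ₂, z = ⟨gridPoint γ₂ k, gridPoint_mem_cube hγ₂ k⟩ := ⟨_, rfl⟩
  -- Error budget: `ε / 2` for the grid in the output variable, `ε / 4` for the net `T`, and `ε / 8`
  -- for sampling at the points `c l`.
  have hyz : |(G u).1 y - (G u).1 z| ≤ ε / 2 := by
    have h1 := (hV _ (G u).2).1 y z
    have h2 := norm_sub_gridPoint_le hγ₂ (by positivity) hm y.2 hk
    rw [hz] at h1 ⊢
    refine h1.trans ((mul_le_mul_of_nonneg_left h2 hL_V.le).trans (le_of_eq ?_))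
    field_simp
    norm_num
  have he : Λ * (2 * L_U * δ) ≤ ε / 8 := by
    calc Λ * (2 * L_U * δ) ≤ Λ * (2 * L_U * (1 / (16 * Λ * L_U) * ε)) := by gcongr
      _ = ε / 8 := by field_simp; norm_num
  have hmc := abs_sub_mcShane_le (w := fun (t : T) l => t.1 (c l))
    (g := fun t => (G ⟨t.1, hTU t⟩).1 z) (v := fun l => u.1 (c l)) (e := ε / 8)
    (r := ε / (8 * Λ)) hΛ0.le ((hV _ (G u).2).2 z) (by positivity) (by positivity) ?_ ?_
  · rw [← hz]
    have h3 : 2 * Λ * (ε / (8 * Λ)) = ε / 4 := by field_simp; norm_num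
    rw [h3] at hmc
    rw [abs_le] at *
    constructor <;> linarith
  · intro t S hS hts
    have hsup : ∀ x, |u.1 x - t.1 x| ≤ S + 2 * L_U * δ := by
      intro x
      obtain ⟨l, hl⟩ := Set.mem_iUnion.1 (hcov x.2)
      rw [Metric.mem_closedBall, dist_eq_norm] at hl
      have h1 := ((hU _ u.2).1 x (c l)).trans (mul_le_mul_of_nonneg_left hl hL_U.le)
      have h2 := ((hU _ (hTU t)).1 x (c l)).trans (mul_le_mul_of_nonneg_left hl hL_U.le)
      have h3 := hts l
      rw [abs_le] at *
      constructor <;> linarith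
    have := hG.abs_sub_le hL_G.le (by positivity) (u₁ := u) (u₂ := ⟨t.1, hTU t⟩) hsup z
    rw [← hΛ, mul_add] at this
    linarith
  · obtain ⟨u', hu', h⟩ := hT u.1 u.2
    exact ⟨⟨u', hu'⟩, fun l => h (c l)⟩

/-! ### The approximation theorem -/

/-- The constant in the resolution `δ` of the cover. -/
noncomputable def coverConst (γ : ℝ) (d : ℕ) (L_G L_U : ℝ) : ℝ :=
  min (γ / (4 * entropyExponent (128 * d * γ * L_U * (L_G * cubeL2Const γ d)) *
      (128 * d * γ * L_U * (L_G * cubeL2Const γ d))))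
    (1 / (16 * (L_G * cubeL2Const γ d) * L_U))

/-- Approximation of Lipschitz operators by DeepONets. The arguments of the functions `C` and `Cδ`
say on which parameters these constants depend; `A` is the constant in the `O`-bounds. The
`O`-bounds are written with `η = min ε (1/2)`, which is `ε` as soon as `ε ≤ 1/2`. -/
theorem theorem1 :
    ∃ (C : (d₂ : ℕ) → (L_V γ₂ : ℝ) → ℝ) (Cδ : (γ₁ : ℝ) → (d₁ : ℕ) → (L_G L_U : ℝ) → ℝ),
      ∀ (d₁ d₂ : ℕ) (γ₁ γ₂ β_U β_V L_U L_V L_G : ℝ), 0 < d₁ → 0 < d₂ → 0 < γ₁ → 0 < γ₂ →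
        0 < β_U → 0 < β_V → 0 < L_U → 0 < L_V → 0 < L_G →
      0 < C d₂ L_V γ₂ ∧ 0 < Cδ γ₁ d₁ L_G L_U ∧
      ∃ A : ℝ, 0 < A ∧
      ∀ (U : Set (cube d₁ γ₁ → ℝ)) (V : Set (cube d₂ γ₂ → ℝ)),
        IsLipschitzBoundedClass L_U β_U U → IsLipschitzBoundedClass L_V β_V V →
      ∀ ε δ η : ℝ, 0 < ε → δ = Cδ γ₁ d₁ L_G L_U * ε → η = min ε (1 / 2) →
      ∀ N : ℕ, N = ⌈C d₂ L_V γ₂ * (1 / ε) ^ d₂⌉₊ →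
      ∀ (c_U : ℕ) (c : Fin c_U → cube d₁ γ₁),
        cube d₁ γ₁ ⊆ ⋃ m, Metric.closedBall (c m : EuclideanSpace ℝ (Fin d₁)) δ →
      ∃ (L₁ p₁ K₁ : ℕ) (κ₁ : ℝ) (L₂ p₂ K₂ : ℕ) (κ₂ : ℝ),
        ((L₁ : ℝ) ≤ A * Real.log (1 / η) ∧
          (p₁ : ℝ) ≤ A ∧
          (K₁ : ℝ) ≤ A * Real.log (1 / η) ∧
          κ₁ ≤ A * (1 / η)) ∧
        ((L₂ : ℝ) ≤ A * ((c_U : ℝ) ^ 2 * Real.log c_U + (c_U : ℝ) ^ 2 * Real.log (1 / η)) ∧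
          (p₂ : ℝ) ≤ A * (Real.sqrt c_U * (1 / η) ^ ((d₂ + 1) * c_U)) ∧
          (K₂ : ℝ) ≤ A * ((Real.sqrt c_U * (1 / η) ^ ((d₂ + 1) * c_U)) *
            ((c_U : ℝ) ^ 2 * Real.log c_U + (c_U : ℝ) ^ 2 * Real.log (1 / η))) ∧
          κ₂ ≤ A * ((c_U : ℝ) ^ ((c_U : ℝ) / 2 + 1) * (1 / η) ^ ((d₂ + 1) * (c_U + 1)))) ∧
        ∀ G : U → V, IsLipschitzOperator L_G G →
          ∃ (q : Fin N → (Fin d₂ → ℝ) → ℝ) (a : Fin N → (Fin c_U → ℝ) → ℝ),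
            (∀ k, q k ∈ FNN d₂ L₁ p₁ K₁ κ₁ 1) ∧
            (∀ k, a k ∈ FNN c_U L₂ p₂ K₂ κ₂ β_V) ∧
            ∀ (u : U) (y : cube d₂ γ₂),
              |(G u).1 y - ∑ k, a k (fun m => u.1 (c m)) *
                q k (fun i => (y : EuclideanSpace ℝ (Fin d₂)) i)| ≤ ε := by

  -- With `a = 8 * d₂ * γ₂ * L_V` and `m = ⌊a / ε⌋₊`, the grid has `(m + 1) ^ d₂` nodes, at most the
  -- ceiling of `(2 * a / ε) ^ d₂`.
  refine ⟨fun d L γ => (2 * (8 * d * γ * L)) ^ d, coverConst, ?_⟩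
  intro d₁ d₂ γ₁ γ₂ β_U β_V L_U L_V L_G hd₁ hd₂ hγ₁ hγ₂ hβ_U hβ_V hL_U hL_V hL_G
  obtain ⟨Λ, hΛ⟩ : ∃ Λ, Λ = L_G * cubeL2Const γ₁ d₁ := ⟨_, rfl⟩
  have hΛ0 : 0 < Λ := by rw [hΛ]; exact mul_pos hL_G (cubeL2Const_pos _ _)
  have hd₁' : (0 : ℝ) < d₁ := by exact_mod_cast hd₁
  have hd₂' : (0 : ℝ) < d₂ := by exact_mod_cast hd₂
  have hexp : (0 : ℝ) < entropyExponent (128 * d₁ * γ₁ * L_U * Λ) := by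
    unfold entropyExponent
    positivity
  have hCδ : 0 < coverConst γ₁ d₁ L_G L_U := by
    unfold coverConst
    rw [← hΛ]
    exact lt_min (by positivity) (by positivity)
  refine ⟨by positivity, hCδ, ?_⟩
  obtain ⟨L₁, p₁, K₁, htrunk⟩ := exists_trunk_class d₂
  obtain ⟨a, ha⟩ : ∃ a, a = 8 * d₂ * γ₂ * L_V := ⟨_, rfl⟩
  have ha0 : 0 < a := by rw [ha]; positivity
  obtain ⟨B, hB⟩ : ∃ B, B = 64 * Λ * β_U + 2 := ⟨_, rfl⟩
  have hB0 : 0 ≤ B := by rw [hB]; positivity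
  obtain ⟨κ, hκ⟩ : ∃ κ, κ = 2 * (3 + Λ + β_V + Λ * β_U) := ⟨_, rfl⟩
  have hκ0 : 0 ≤ κ := by rw [hκ]; positivity
  obtain ⟨κ', hκ'⟩ : ∃ κ', κ' = 2 * (3 + a * (1 + 1 / γ₂)) := ⟨_, rfl⟩
  have hκ'0 : 0 ≤ κ' := by rw [hκ']; positivity
  have hL₁ : (0 : ℝ) ≤ L₁ := Nat.cast_nonneg _
  have hp₁ : (0 : ℝ) ≤ p₁ := Nat.cast_nonneg _
  have hK₁ : (0 : ℝ) ≤ K₁ := Nat.cast_nonneg _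
  -- The trunk depth and sparsity are constants; the factors 2 turn them into multiples of `log (1 /
  -- η) ≥ 1 / 2`.
  obtain ⟨A, hA⟩ : ∃ A : ℝ, A = 2 * L₁ + p₁ + 2 * K₁ + κ + κ' + 400 * (B + 1) := ⟨_, rfl⟩
  have hA0 : 0 < A := by rw [hA]; positivity
  have hBA : 400 * (B + 1) ≤ A := by linarith
  have hκA : κ ≤ A := by linarith
  have hκ'A : κ' ≤ A := by linarith
  have hL₁A : (L₁ : ℝ) ≤ A * (1 / 2) := by linarith
  have hp₁A : (p₁ : ℝ) ≤ A := by linarith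
  have hK₁A : (K₁ : ℝ) ≤ A * (1 / 2) := by linarith
  clear hA
  refine ⟨A, hA0, ?_⟩
  intro U V hU hV ε δ η hε hδ hη N hN n c hcov
  obtain ⟨hδ0, hn⟩ := nonneg_of_cover hγ₁ c hcov
  have : NeZero n := ⟨hn.ne'⟩
  have hη0 : 0 < η := by rw [hη]; exact lt_min hε (by norm_num)
  obtain ⟨H, hH⟩ : ∃ H, H = 1 / η := ⟨_, rfl⟩
  have hH2 : 2 ≤ H := by
    rw [hH, le_div_iff₀ hη0]
    linarith [hη ▸ min_le_right ε (1 / 2)]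
  have hεH : 1 / ε ≤ H := by
    rw [hH]
    exact one_div_le_one_div_of_le hη0 (hη ▸ min_le_left _ _)
  have hδ₁ : δ ≤ γ₁ / (4 * entropyExponent (128 * d₁ * γ₁ * L_U * Λ) *
      (128 * d₁ * γ₁ * L_U * Λ)) * ε := by
    rw [hδ, hΛ]
    exact mul_le_mul_of_nonneg_right (min_le_left _ _) hε.le
  have hδ₂ : δ ≤ 1 / (16 * Λ * L_U) * ε := by
    rw [hδ, hΛ]
    exact mul_le_mul_of_nonneg_right (min_le_right _ _) hε.le
  obtain ⟨T, hTU, hTcard, hT⟩ := hU.exists_net_of_cover hd₁ hγ₁ hL_U hβ_U.le hΛ0 hε hH2 hεH hδ0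
    hδ₁ c hcov
  obtain ⟨L₂, p₂, K₂, hL₂, hp₂, hK₂, hbranch⟩ := exists_branch_class T n
  have hq : (((Fintype.card T + 1) * (2 * n) : ℕ) : ℝ) ≤ (B + 1) * H ^ (n + 1) * (2 * n) := by
    rw [Fintype.card_coe]
    push_cast
    have : 1 ≤ H ^ (n + 1) := one_le_pow₀ (by linarith)
    rw [← hB] at hTcard
    exact mul_le_mul_of_nonneg_right (by linarith) (by positivity)
  obtain ⟨hbL, hbp, hbK⟩ := branch_size_bounds hn hH2 hB0 hd₂ hq hL₂ hp₂ hK₂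
  have hn1 : (1 : ℝ) ≤ n := by exact_mod_cast hn
  have hlog2 : (1 : ℝ) / 2 ≤ Real.log 2 := by linarith [Real.log_two_gt_d9]
  have hlogH : (1 : ℝ) / 2 ≤ Real.log H := hlog2.trans (Real.log_le_log (by norm_num) hH2)
  have hX : 0 ≤ (n : ℝ) ^ 2 * Real.log n + (n : ℝ) ^ 2 * Real.log H := by
    have := Real.log_nonneg hn1
    positivity
  have hH0 : 0 < H := by linarith
  obtain ⟨m, hm⟩ : ∃ m, m = ⌊a / ε⌋₊ := ⟨_, rfl⟩
  obtain ⟨htk, ht0⟩ := htrunk m γ₂ hγ₂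
  obtain ⟨hbr, hb0⟩ := hbranch Λ β_V β_U hΛ0.le hβ_V.le hβ_U.le
  rw [← hκ] at hbr hb0
  rw [← hH]
  refine ⟨L₁, p₁, K₁, 2 * (3 + m * (1 + 1 / γ₂)), L₂, p₂, K₂, κ, ⟨?_, ?_, ?_, ?_⟩,
    ⟨?_, ?_, ?_, ?_⟩, fun G hG => ?_⟩
  · exact hL₁A.trans (mul_le_mul_of_nonneg_left hlogH hA0.le)
  · exact hp₁A
  · exact hK₁A.trans (mul_le_mul_of_nonneg_left hlogH hA0.le)
  · have h1 : (m : ℝ) ≤ a * H := by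
      rw [hm]
      refine (Nat.floor_le (by positivity)).trans ?_
      rw [div_eq_mul_one_div]
      exact mul_le_mul_of_nonneg_left hεH ha0.le
    have h2 : (m : ℝ) * (1 + 1 / γ₂) ≤ a * H * (1 + 1 / γ₂) :=
      mul_le_mul_of_nonneg_right h1 (by positivity)
    have h3 : κ' * H ≤ A * H := mul_le_mul_of_nonneg_right hκ'A hH0.le
    rw [hκ'] at h3
    linarith
  · exact hbL.trans (mul_le_mul_of_nonneg_right hBA hX)
  · exact hbp.trans (mul_le_mul_of_nonneg_right hBA (by positivity))
  · exact hbK.trans (mul_le_mul_of_nonneg_right hBA (mul_nonneg (by positivity) hX))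
  · have h1 : 1 ≤ (n : ℝ) ^ ((n : ℝ) / 2 + 1) := Real.one_le_rpow hn1 (by positivity)
    have h2 : 1 ≤ H ^ ((d₂ + 1) * (n + 1)) := one_le_pow₀ (by linarith)
    have h3 := one_le_mul_of_one_le_of_one_le h1 h2
    exact hκA.trans (le_mul_of_one_le_right hA0.le h3)
  · have hcard : Fintype.card (Fin d₂ → Fin (m + 1)) ≤ Fintype.card (Fin N) := by
      have := pow_floor_succ_le_ceil d₂ ha0 hε
      simpa [hN, hm, ha] using this
    obtain ⟨e⟩ := Function.Embedding.nonempty_of_card_le hcard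
    let q : (Fin d₂ → Fin (m + 1)) → (Fin d₂ → ℝ) → ℝ := fun k y =>
      kuhnHat (latticeOffset k (gridCoord m γ₂ y))
    let b : (Fin d₂ → Fin (m + 1)) → (Fin n → ℝ) → ℝ := fun k =>
      mcShane (fun (t : T) l => t.1 (c l))
        (fun t => (G ⟨t.1, hTU t.2⟩).1 ⟨gridPoint γ₂ k, gridPoint_mem_cube hγ₂ k⟩) Λ β_V
    -- `N` may exceed the number of grid nodes; the surplus trunk and branch nets are zero.
    refine ⟨Function.extend e q fun _ _ => 0, Function.extend e b fun _ _ => 0, fun k => ?_,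
      fun k => ?_, fun u y => ?_⟩
    · by_cases hk : ∃ l, e l = k
      · obtain ⟨l, rfl⟩ := hk
        rw [e.injective.extend_apply]
        exact htk l
      · rw [Function.extend_apply' _ _ _ hk]
        exact ht0
    · by_cases hk : ∃ l, e l = k
      · obtain ⟨l, rfl⟩ := hk
        rw [e.injective.extend_apply]
        exact hbr _ _ (fun t l => (hU _ (hTU t.2)).2 _) fun t => (hV _ (G _).2).2 _
      · rw [Function.extend_apply' _ _ _ hk]
        exact hb0
    · rw [← Fintype.sum_of_injective e e.injective
        (fun k => b k (fun l => u.1 (c l)) * q k (y : EuclideanSpace ℝ (Fin d₂))) _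
        (fun k hk => ?_) fun k => ?_]
      · exact deepONet_error hγ₂ hd₂ hL_U hL_V hL_G hε hδ0 hΛ hδ₂ (ha ▸ hm) hU hV c hcov
          (fun t => hTU t.2) hT hG u y
      · rw [Function.extend_apply' _ _ _ (by simpa using hk), zero_mul]
      · simp only [e.injective.extend_apply]
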